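/- Let $\mathbf{V}=\mathbf{Q}^{\infty|\infty}$, and let $\mathrm{GL}_{\infty|\infty}=\bigcup_{r,s}\mathrm{GL}_{r|s}$ be the inductive system of algebraic supergroups over $\mathbf{Q}$. A polynomial representation of $\mathrm{GL}_{\infty|\infty}$ is an algebraic representation (a super vector space with compatible algebraic representations of all the $\mathrm{GL}_{r|s}$) that is a subquotient, through even equivariant maps, of a possibly infinite direct sum of tensor powers of $\mathbf{V}$; let $\mathrm{Rep}^{\mathrm{pol}}(\mathrm{GL}_{\infty|\infty})$ be the category of these. A twisted commutative algebra (tca) in $\mathrm{Rep}^{\mathrm{pol}}(\mathrm{GL}_{\infty|\infty})$ is a commutative algebra object of this tensor category: a supercommutative unital $\mathbf{Q}$-superalgebra $A$ whose underlying super vector space is a polynomial representation of $\mathrm{GL}_{\infty|\infty}$, such that the unit and the multiplication are equivariant. A $\mathrm{GL}$-ideal of $A$ is an ideal that is a subrepresentation, and a $\mathrm{GL}$-prime of $A$ is a proper $\mathrm{GL}$-ideal $\mathfrak{p}$ such that for all subrepresentations $V,W\subset A$, if the image $VW$ of $V\otimes W\to A$ is contained in $\mathfrak{p}$, then $V\subset\mathfrak{p}$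 or $W\subset\mathfrak{p}$. **Proposition.** Let $A$ be a tca in $\mathrm{Rep}^{\mathrm{pol}}(\mathrm{GL}_{\infty|\infty})$ and let $\mathfrak{p}$ be a $\mathrm{GL}$-prime of $A$. Then $\mathrm{rad}(\mathfrak{p})=\{x\in A : x^n\in\mathfrak{p}\text{ for some } n\ge 0\}$ is a prime ideal of $A$; that is, it is a proper two-sided ideal, and $xy\in\mathrm{rad}(\mathfrak{p})$ implies $x\in\mathrm{rad}(\mathfrak{p})$ or $y\in\mathrm{rad}(\mathfrak{p})$ for all $x,y\in A$. -/

import Mathlib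

open scoped TensorProduct DirectSum

universe u

/-! ### Super vector spaces and supercommutative algebras

A super vector space is a rational vector space with a `ZMod 2`-grading, given by the family of its
even part (index `0`) and odd part (index `1`). -/

/-- The Koszul sign rule `a b = (-1)^{|a||b|} b a` for homogeneous elements of a superalgebra. -/
def IsSuperCommutative {A : Type u} [Ring A] [Algebra ℚ A] (𝒜 : ZMod 2 → Submodule ℚ A) : Prop :=
  ∀ (i j : ZMod 2) (a b : A), a ∈ 𝒜 i → b ∈ 𝒜 j → a * b = (-1 : ℤˣ) ^ (i * j) • (b * a)

/-- A supercommutative `ℚ`-superalgebra: a test object for the functor of points of the supergroup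
`GL_{∞|∞}`. (The coordinate superalgebras of the supergroups `GL_{r|s}` are among these.) -/
structure SuperCommAlg where
  carrier : Type
  [ring : Ring carrier]
  [algebra : Algebra ℚ carrier]
  grading : ZMod 2 → Submodule ℚ carrier
  [graded : GradedAlgebra grading]
  supercomm : IsSuperCommutative grading

namespace SuperCommAlg

instance : CoeSort SuperCommAlg Type := ⟨carrier⟩

attribute [instance] SuperCommAlg.ring SuperCommAlg.algebra SuperCommAlg.graded

/-- Homomorphisms of superalgebras: parity-preserving `ℚ`-algebra homomorphisms. -/
structure Hom (R S : SuperCommAlg) where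
  toAlgHom : R →ₐ[ℚ] S
  map_grading : ∀ (i : ZMod 2) (x : R), x ∈ R.grading i → toAlgHom x ∈ S.grading i

end SuperCommAlg

/-- The homogeneous part of degree `k` of the tensor product of two super vector spaces. -/
def superTensor {V W : Type*} [AddCommGroup V] [Module ℚ V] [AddCommGroup W] [Module ℚ W]
    (𝒱 : ZMod 2 → Submodule ℚ V) (𝒲 : ZMod 2 → Submodule ℚ W) (k : ZMod 2) :
    Submodule ℚ (V ⊗[ℚ] W) :=
  Submodule.span ℚ {z | ∃ i j : ZMod 2, i + j = k ∧ ∃ v ∈ 𝒱 i, ∃ w ∈ 𝒲 j, z = v ⊗ₜ[ℚ] w}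

/-- A subspace of a super vector space is a super subspace if it is spanned by its homogeneous
elements. -/
def IsSuperSubspace {V : Type*} [AddCommGroup V] [Module ℚ V] (𝒱 : ZMod 2 → Submodule ℚ V)
    (W : Submodule ℚ V) : Prop :=
  W ≤ ⨆ i, W ⊓ 𝒱 i

/-! ### The supergroup `GL_{∞|∞}` -/

/-- Indices of the homogeneous basis of `ℚ^{∞|∞}`: `Sum.inl n` is even and `Sum.inr n` is odd. -/
abbrev SuperIndex : Type := ℕ ⊕ ℕ

namespace SuperIndex

/-- The parity of a basis vector. -/
def parity : SuperIndex → ZMod 2 := Sum.elim (fun _ => 0) (fun _ => 1)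

end SuperIndex

/-- The underlying vector space of `ℚ^{∞|∞}`. -/
abbrev StdSpace : Type := SuperIndex →₀ ℚ

/-- The super grading of `ℚ^{∞|∞}`. -/
def stdGrading (k : ZMod 2) : Submodule ℚ StdSpace :=
  Finsupp.supported ℚ ℚ {i | i.parity = k}

/-- The basis vector `1 ⊗ e_i` of the free `R`-module `R ⊗ ℚ^{∞|∞}`. -/
noncomputable def stdBasis (R : SuperCommAlg) (i : SuperIndex) : R ⊗[ℚ] StdSpace :=
  1 ⊗ₜ[ℚ] Finsupp.single i 1

/-- The group of `R`-points of `GL_{∞|∞} = ⋃ GL_{r|s}`: parity-preserving `R`-linear automorphisms of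
`R ⊗ ℚ^{∞|∞}` which fix all but finitely many of the basis vectors. (Such an automorphism is the
identity on all basis vectors outside some `R^{r|s}` and maps `R^{r|s}` to itself when `r` and `s` are
large, since almost all basis vectors are fixed and the images of the remaining ones have finite
support.) -/
def superGL (R : SuperCommAlg) : Subgroup ((R ⊗[ℚ] StdSpace) ≃ₗ[R] (R ⊗[ℚ] StdSpace)) where
  carrier := {g |
    (∀ k, ∀ x ∈ superTensor R.grading stdGrading k, g x ∈ superTensor R.grading stdGrading k) ∧
    (∀ k, ∀ x ∈ superTensor R.grading stdGrading k, g⁻¹ x ∈ superTensor R.grading stdGrading k) ∧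
    {i | g (stdBasis R i) ≠ stdBasis R i}.Finite}
  mul_mem' := by
    rintro a b ⟨ha, ha', fa⟩ ⟨hb, hb', fb⟩
    refine ⟨fun k x hx => ha k _ (hb k x hx), fun k x hx => ?_, (fa.union fb).subset ?_⟩
    · rw [mul_inv_rev]
      exact hb' k _ (ha' k x hx)
    · intro i hi
      by_contra h
      simp only [Set.mem_union, Set.mem_ofPred_eq, not_or, not_not] at h
      exact hi (by rw [LinearEquiv.mul_apply, h.2, h.1])
  one_mem' := by
    refine ⟨fun k x hx => hx, fun k x hx => ?_, ?_⟩
    · rw [inv_one]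
      exact hx
    · simp
  inv_mem' := by
    rintro a ⟨ha, ha', fa⟩
    refine ⟨ha', fun k x hx => ?_, fa.subset ?_⟩
    · rw [inv_inv]
      exact ha k x hx
    · intro i hi h
      apply hi
      have h2 : a⁻¹ (a (stdBasis R i)) = stdBasis R i := by
        rw [← LinearEquiv.mul_apply, inv_mul_cancel, LinearEquiv.coe_one, id]
      rwa [h] at h2

/-! ### Algebraic representations of `GL_{∞|∞}` -/

/-- An algebraic representation of `GL_{∞|∞}` on a super vector space `V`: for every supercommutative
superalgebra `R`, an action of `GL_{∞|∞}(R)` on `R ⊗ V` by even `R`-linear maps, natural in `R`. -/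
structure SuperGLRep {V : Type u} [AddCommGroup V] [Module ℚ V]
    (𝒱 : ZMod 2 → Submodule ℚ V) where
  act : ∀ R : SuperCommAlg, superGL R →* Module.End R (R ⊗[ℚ] V)
  act_even : ∀ (R : SuperCommAlg) (g : superGL R) (k : ZMod 2),
    ∀ x ∈ superTensor R.grading 𝒱 k, act R g x ∈ superTensor R.grading 𝒱 k
  /-- If `g'` is the base change of `g` along `f : R → S`, then its action on `S ⊗ V` is the base
  change of the action of `g` on `R ⊗ V`. -/
  act_natural : ∀ (R S : SuperCommAlg) (f : R.Hom S) (g : superGL R) (g' : superGL S),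
    (∀ x, g'.1 (f.toAlgHom.toLinearMap.rTensor StdSpace x) =
      f.toAlgHom.toLinearMap.rTensor StdSpace (g.1 x)) →
    ∀ x, act S g' (f.toAlgHom.toLinearMap.rTensor V x) =
      f.toAlgHom.toLinearMap.rTensor V (act R g x)

/-- A subrepresentation: a super subspace `W` such that `R ⊗ W` is stable under `GL_{∞|∞}(R)` for
all `R`. -/
structure SuperGLRep.IsSubrep {V : Type u} [AddCommGroup V] [Module ℚ V]
    {𝒱 : ZMod 2 → Submodule ℚ V} (ρ : SuperGLRep 𝒱) (W : Submodule ℚ V) : Prop where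
  super : IsSuperSubspace 𝒱 W
  stable : ∀ (R : SuperCommAlg) (g : superGL R), ∀ w ∈ W,
    ρ.act R g (1 ⊗ₜ[ℚ] w) ∈ LinearMap.range (W.subtype.lTensor R)

/-! ### Tensor powers of the standard representation

The direct sum `T = ⨁ₙ (ℚ^{∞|∞})^{⊗n}` of all tensor powers is the free associative algebra on the
basis vectors `e_i`: it has the words `e_{i₁} ⊗ ⋯ ⊗ e_{iₙ}` as a basis, with concatenation as the
product. -/

/-- The parity of a word is the sum of the parities of its letters. -/
def wordParity : FreeAddMonoid SuperIndex →+ ZMod 2 := FreeAddMonoid.lift SuperIndex.parity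

/-- The direct sum of all tensor powers of `ℚ^{∞|∞}`. -/
abbrev TensorPowers : Type := AddMonoidAlgebra ℚ (FreeAddMonoid SuperIndex)

/-- The super grading on tensor powers. -/
noncomputable abbrev tensorPowersGrading : ZMod 2 → Submodule ℚ TensorPowers :=
  AddMonoidAlgebra.gradeBy ℚ wordParity

/-- The inclusion of `ℚ^{∞|∞}`, as the first tensor power. -/
noncomputable def stdInclusion : StdSpace →ₗ[ℚ] TensorPowers :=
  Finsupp.linearCombination ℚ fun i => AddMonoidAlgebra.single (FreeAddMonoid.of i) 1

/-- The action of `g ∈ GL_{∞|∞}(R)` on tensor powers, restricted to elements `1 ⊗ t`. It is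
multiplicative, `e_{i₁} ⊗ ⋯ ⊗ e_{iₙ} ↦ g e_{i₁} ⋯ g e_{iₙ}`, for the product of the
super tensor product of algebras `R ⊗ T`, whose signs are given by the Koszul rule. -/
noncomputable def tensorPowersAct (R : SuperCommAlg) (g : superGL R) :
    TensorPowers →ₐ[ℚ] R.grading ᵍ⊗[ℚ] tensorPowersGrading :=
  AddMonoidAlgebra.lift ℚ _ _ <| AddMonoidHom.toMultiplicativeLeft <|
    FreeAddMonoid.lift fun i => Additive.ofMul <|
      GradedTensorProduct.of ℚ R.grading tensorPowersGrading
        (stdInclusion.lTensor R (g.1 (stdBasis R i)))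

/-- The super grading on the direct sum of `κ` copies of the tensor powers. -/
def sumTensorPowersGrading (κ : Type u) (k : ZMod 2) : Submodule ℚ (κ →₀ TensorPowers) where
  carrier := {f | ∀ c, f c ∈ tensorPowersGrading k}
  add_mem' hf hg c := add_mem (hf c) (hg c)
  zero_mem' _ := zero_mem _
  smul_mem' r _ hf c := Submodule.smul_mem _ r (hf c)

/-- The action of `g ∈ GL_{∞|∞}(R)` on the direct sum of `κ` copies of the tensor powers, restricted to
elements `1 ⊗ t`. -/
noncomputable def sumTensorPowersAct (κ : Type u) (R : SuperCommAlg) (g : superGL R) :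
    (κ →₀ TensorPowers) →ₗ[ℚ] R ⊗[ℚ] (κ →₀ TensorPowers) :=
  Finsupp.lsum ℚ fun c =>
    (Finsupp.lsingle (R := ℚ) c).lTensor R ∘ₗ
      (GradedTensorProduct.of ℚ R.grading tensorPowersGrading).symm.toLinearMap ∘ₗ
        (tensorPowersAct R g).toLinearMap

/-- A representation is polynomial if it is a subquotient of a (possibly infinite) direct sum of tensor
powers of `ℚ^{∞|∞}`: there is a subrepresentation `N` of such a direct sum and a surjective even map
`φ` from `N` to `V` which commutes with `GL_{∞|∞}(R)` for all `R`. -/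
def SuperGLRep.IsPolynomial {V : Type u} [AddCommGroup V] [Module ℚ V]
    {𝒱 : ZMod 2 → Submodule ℚ V} (ρ : SuperGLRep 𝒱) : Prop :=
  ∃ (κ : Type u) (N : Submodule ℚ (κ →₀ TensorPowers)) (φ : N →ₗ[ℚ] V),
    IsSuperSubspace (sumTensorPowersGrading κ) N ∧
    (∀ k, ∀ n : N, n.1 ∈ sumTensorPowersGrading κ k → φ n ∈ 𝒱 k) ∧
    Function.Surjective φ ∧
    ∀ (R : SuperCommAlg) (g : superGL R) (n : N), ∃ z : R ⊗[ℚ] N,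
      N.subtype.lTensor R z = sumTensorPowersAct κ R g n.1 ∧
      φ.lTensor R z = ρ.act R g (1 ⊗ₜ[ℚ] φ n)

/-! ### Twisted commutative algebras and their ideals -/

/-- The structure of a twisted commutative algebra in `Rep^pol(GL_{∞|∞})` on a superalgebra `A`: `A` is
supercommutative and carries a polynomial representation of `GL_{∞|∞}` for which the unit and the
multiplication of `A` are equivariant. Equivariance of the multiplication means that every
`g ∈ GL_{∞|∞}(R)` acts multiplicatively on the super tensor product of algebras `R ⊗ A`. -/
structure SuperTCA {A : Type u} [Ring A] [Algebra ℚ A] (𝒜 : ZMod 2 → Submodule ℚ A)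
    [GradedAlgebra 𝒜] extends SuperGLRep 𝒜 where
  supercomm : IsSuperCommutative 𝒜
  polynomial : toSuperGLRep.IsPolynomial
  act_one : ∀ (R : SuperCommAlg) (g : superGL R),
    act R g (1 ⊗ₜ[ℚ] (1 : A)) = 1 ⊗ₜ[ℚ] (1 : A)
  act_mul : ∀ (R : SuperCommAlg) (g : superGL R) (x y : R.grading ᵍ⊗[ℚ] 𝒜),
    GradedTensorProduct.of ℚ R.grading 𝒜
        (act R g ((GradedTensorProduct.of ℚ R.grading 𝒜).symm (x * y))) =
      GradedTensorProduct.of ℚ R.grading 𝒜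
          (act R g ((GradedTensorProduct.of ℚ R.grading 𝒜).symm x)) *
        GradedTensorProduct.of ℚ R.grading 𝒜
          (act R g ((GradedTensorProduct.of ℚ R.grading 𝒜).symm y))

namespace SuperTCA

variable {A : Type u} [Ring A] [Algebra ℚ A] {𝒜 : ZMod 2 → Submodule ℚ A} [GradedAlgebra 𝒜]

/-- A `GL`-ideal is an ideal which is a subrepresentation. (Being a super subspace of a
supercommutative algebra, a left ideal of this kind is two-sided.) -/
def IsGLIdeal (T : SuperTCA 𝒜) (I : Ideal A) : Prop :=
  T.IsSubrep (I.restrictScalars ℚ)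

/-- A `GL`-prime is a proper `GL`-ideal `p` such that `V W ⊆ p` implies `V ⊆ p` or `W ⊆ p`
for subrepresentations `V` and `W`, where `V W` is the image of `V ⊗ W → A`. -/
structure IsGLPrime (T : SuperTCA 𝒜) (p : Ideal A) : Prop where
  isGLIdeal : T.IsGLIdeal p
  ne_top : p ≠ ⊤
  subrep_le : ∀ V W : Submodule ℚ A, T.IsSubrep V → T.IsSubrep W →
    V * W ≤ p.restrictScalars ℚ → V ≤ p.restrictScalars ℚ ∨ W ≤ p.restrictScalars ℚ

end SuperTCA

/-! Odd elements square to zero, so rad(p) is the preimage, under projection to the even part A₀, of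
the radical of p₀ = p ∩ A₀, and this projection is multiplicative modulo that radical. It remains to
treat even x, y with xy ∈ rad(p) (`IsGLPrime.even_mem_or_mem`).

Polynomiality of A means that each element involves only finitely many basis vectors e_i, and that
the action on it is polynomial in the images of these (`IsPolynomial.exists_hasBound`). Let G(t) be
a family of rational points, affine in t on the basis, with G(0) = 1. Then G(t)x · G(t)y stays in
the radical. Modulo a prime q ⊇ p₀ of A₀ both factors are polynomial functions of t with values in a
domain, so one of them vanishes identically: x = G(0)x ∈ q, or G(s)y ∈ q for all s. Either way x ·
G(s)y ∈ q for every q, hence it lies in the radical (`mul_ratAct_mem_radical`). A shift moving y off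
the basis vectors of x is a product of two such shears, so a · b' ∈ p, where a = xⁿ and b' is the
shift of b = yⁿ.

Now a and b' involve disjoint sets of basis vectors, so group elements fixing a can move b' almost
freely. Letting a parameter tend to 0 gives a · gb ∈ p for all points g over all superalgebras R,
where gb is read through its coefficients (`mul_coeff_act_mem`). Thus b lies in a subrepresentation
W with aW ⊆ p, while a lies in the subrepresentation V = (p : W). Since VW ⊆ p, `GL`-primality gives
a ∈ p or b ∈ p (`IsGLPrime.mem_or_mem`). -/

/-! ### Polynomial functions of a rational parameter -/

/-- Polynomial functions from `ℚ` to a rational vector space. -/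
def polyFun (M : Type*) [AddCommGroup M] [Module ℚ M] : Submodule ℚ (ℚ → M) :=
  Submodule.span ℚ {F | ∃ (k : ℕ) (m : M), F = fun t => t ^ k • m}

section PolyFun

variable {M N : Type*} [AddCommGroup M] [Module ℚ M] [AddCommGroup N] [Module ℚ N]

theorem polyFun_const (m : M) : (fun _ => m) ∈ polyFun M :=
  Submodule.subset_span ⟨0, m, by simp⟩

theorem polyFun_affine (u v : M) : (fun t : ℚ => u + t • v) ∈ polyFun M :=
  add_mem (polyFun_const u) (Submodule.subset_span ⟨1, v, by simp⟩)

theorem polyFun_map (f : M →ₗ[ℚ] N) {F : ℚ → M} (hF : F ∈ polyFun M) :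
    (fun t => f (F t)) ∈ polyFun N := by
  induction hF using Submodule.span_induction with
  | mem x h =>
    obtain ⟨k, m, rfl⟩ := h
    exact Submodule.subset_span ⟨k, f m, by simp⟩
  | zero =>
    simp only [Pi.zero_apply, map_zero]
    exact zero_mem (polyFun N)
  | add x y _ _ hx hy =>
    simp only [Pi.add_apply, map_add]
    exact add_mem hx hy
  | smul a x _ hx =>
    simp only [Pi.smul_apply, map_smul]
    exact Submodule.smul_mem _ a hx

theorem polyFun_mul {B : Type*} [Ring B] [Algebra ℚ B] {F G : ℚ → B}
    (hF : F ∈ polyFun B) (hG : G ∈ polyFun B) : (fun t => F t * G t) ∈ polyFun B := by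
  have h : F * G ∈ polyFun B := by
    have := Submodule.mul_mem_mul hF hG
    rw [polyFun, Submodule.span_mul_span] at this
    refine Submodule.span_mono ?_ this
    rintro _ ⟨_, ⟨k, m, rfl⟩, _, ⟨l, n, rfl⟩, rfl⟩
    exact ⟨k + l, m * n, funext fun t => by
      rw [pow_add]
      exact smul_mul_smul_comm _ _ _ _⟩
  exact h

theorem polyFun_exists_polynomial {D : Type*} [CommRing D] [Algebra ℚ D] {F : ℚ → D}
    (hF : F ∈ polyFun D) :
    ∃ P : Polynomial D, ∀ t, F t = P.eval (algebraMap ℚ D t) := by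
  induction hF using Submodule.span_induction with
  | mem x h =>
    obtain ⟨k, m, rfl⟩ := h
    exact ⟨Polynomial.C m * Polynomial.X ^ k, fun t => by
      beta_reduce
      rw [Polynomial.eval_mul, Polynomial.eval_C, Polynomial.eval_pow, Polynomial.eval_X,
        Algebra.smul_def, map_pow, mul_comm]⟩
  | zero => exact ⟨0, by simp⟩
  | add x y _ _ hx hy =>
    obtain ⟨P, hP⟩ := hx
    obtain ⟨Q, hQ⟩ := hy
    exact ⟨P + Q, fun t => by simp [hP, hQ]⟩
  | smul a x _ hx =>
    obtain ⟨P, hP⟩ := hx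
    exact ⟨Polynomial.C (algebraMap ℚ D a) * P, fun t => by
      rw [Polynomial.eval_mul, Polynomial.eval_C, ← hP, Pi.smul_apply, Algebra.smul_def]⟩

theorem polynomial_eq_zero_of_eval_rat {D : Type*} [CommRing D] [IsDomain D] [Algebra ℚ D]
    (P : Polynomial D) (h : ∀ t : ℚ, t ≠ 0 → P.eval (algebraMap ℚ D t) = 0) : P = 0 := by
  refine Polynomial.eq_zero_of_infinite_isRoot P ?_
  have hinf : (({0}ᶜ : Set ℚ)).Infinite := (Set.finite_singleton _).infinite_compl
  refine (hinf.image (algebraMap ℚ D).injective.injOn).mono ?_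
  rintro _ ⟨t, ht, rfl⟩
  exact h t ht

/-- If a product of polynomial functions with values in a domain vanishes identically, then so does
one of the factors. -/
theorem polyFun_eq_zero_or {D : Type*} [CommRing D] [IsDomain D] [Algebra ℚ D] {F G : ℚ → D}
    (hF : F ∈ polyFun D) (hG : G ∈ polyFun D) (h : ∀ t, F t * G t = 0) :
    (∀ t, F t = 0) ∨ ∀ t, G t = 0 := by
  obtain ⟨P, hP⟩ := polyFun_exists_polynomial hF
  obtain ⟨Q, hQ⟩ := polyFun_exists_polynomial hG
  have : P * Q = 0 := polynomial_eq_zero_of_eval_rat _ fun t _ => by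
    rw [Polynomial.eval_mul, ← hP, ← hQ, h]
  rcases mul_eq_zero.1 this with h | h
  · exact Or.inl fun t => by simp [hP, h]
  · exact Or.inr fun t => by simp [hQ, h]

/-- A linear form killing `S` but not `F 0` would turn `F` into a rational polynomial that vanishes
at every nonzero rational but not at 0. This is the algebraic substitute for a limit t → 0. -/
theorem polyFun_zero_mem {F : ℚ → M} (hF : F ∈ polyFun M) (S : Submodule ℚ M)
    (h : ∀ t, t ≠ 0 → F t ∈ S) : F 0 ∈ S := by
  by_contra hc
  obtain ⟨f, hf, hS⟩ := Submodule.exists_le_ker_of_notMem hc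
  obtain ⟨P, hP⟩ := polyFun_exists_polynomial (polyFun_map f hF)
  have : P = 0 := polynomial_eq_zero_of_eval_rat _ fun t ht => by
    rw [← hP]
    exact hS (h t ht)
  exact hf (by rw [hP, this]; simp)

theorem polyFun_eq_of_ne_zero {F : ℚ → M} (hF : F ∈ polyFun M) (c : M)
    (h : ∀ t, t ≠ 0 → F t = c) : F 0 = c := by
  have := polyFun_zero_mem (sub_mem hF (polyFun_const c)) ⊥ fun t ht => by simp [h t ht]
  simpa [sub_eq_zero] using this

end PolyFun

/-! ### Points of `GL_{∞|∞}` -/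

namespace SuperIndex

/-- The position of a basis vector among those of the same parity. -/
def idx : SuperIndex → ℕ := Sum.elim id id

/-- The basis vector of the same parity in a given position. -/
def withIdx (n : ℕ) : SuperIndex → SuperIndex := Sum.map (fun _ => n) (fun _ => n)

@[simp] theorem idx_withIdx (n : ℕ) (i : SuperIndex) : (i.withIdx n).idx = n := by
  cases i <;> rfl

@[simp] theorem parity_withIdx (n : ℕ) (i : SuperIndex) : (i.withIdx n).parity = i.parity := by
  cases i <;> rfl

@[simp] theorem withIdx_withIdx (m n : ℕ) (i : SuperIndex) :
    (i.withIdx n).withIdx m = i.withIdx m := by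
  cases i <;> rfl

@[simp] theorem withIdx_idx (i : SuperIndex) : i.withIdx i.idx = i := by
  cases i <;> rfl

/-- The basis vectors with positions in the interval `[L, L + K)`. -/
def block (L K : ℕ) : Set SuperIndex := {i | L ≤ i.idx ∧ i.idx < L + K}

theorem block_finite (L K : ℕ) : (block L K).Finite := by
  refine (((Set.finite_Iio (L + K)).image Sum.inl).union
    ((Set.finite_Iio (L + K)).image Sum.inr)).subset ?_
  rintro (n | n) ⟨_, h⟩
  · exact Or.inl ⟨n, h, rfl⟩
  · exact Or.inr ⟨n, h, rfl⟩

end SuperIndex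

open SuperIndex

/-- The vectors `1 ⊗ e_i` form a basis. -/
noncomputable def stdBasisBasis (R : SuperCommAlg) : Module.Basis SuperIndex R (R ⊗[ℚ] StdSpace) :=
  Algebra.TensorProduct.basis R Finsupp.basisSingleOne

@[simp] theorem stdBasisBasis_apply (R : SuperCommAlg) (i : SuperIndex) :
    stdBasisBasis R i = stdBasis R i := by
  simp [stdBasisBasis, stdBasis]

/-! ### Parity in R ⊗ V. -/

section SuperTensor

variable {V : Type*} [AddCommGroup V] [Module ℚ V] {𝒱 : ZMod 2 → Submodule ℚ V}

theorem tmul_mem_superTensor {R : SuperCommAlg} {i j k : ZMod 2} (h : i + j = k) {r : R} {v : V}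
    (hr : r ∈ R.grading i) (hv : v ∈ 𝒱 j) : r ⊗ₜ[ℚ] v ∈ superTensor R.grading 𝒱 k :=
  Submodule.subset_span ⟨i, j, h, r, hr, v, hv, rfl⟩

theorem one_tmul_mem_superTensor {R : SuperCommAlg} {k : ZMod 2} {v : V} (hv : v ∈ 𝒱 k) :
    (1 : R) ⊗ₜ[ℚ] v ∈ superTensor R.grading 𝒱 k :=
  tmul_mem_superTensor (zero_add k) (SetLike.one_mem_graded R.grading) hv

theorem smul_mem_superTensor {R : SuperCommAlg} {i j : ZMod 2} {r : R} (hr : r ∈ R.grading i)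
    {z : R ⊗[ℚ] V} (hz : z ∈ superTensor R.grading 𝒱 j) :
    r • z ∈ superTensor R.grading 𝒱 (i + j) := by
  induction hz using Submodule.span_induction with
  | mem x h =>
    obtain ⟨a, b, hab, s, hs, w, hw, rfl⟩ := h
    rw [TensorProduct.smul_tmul', smul_eq_mul]
    exact tmul_mem_superTensor (by rw [← hab, add_assoc]) (SetLike.mul_mem_graded hr hs) hw
  | zero => simp
  | add x y _ _ hx hy => rw [smul_add]; exact add_mem hx hy
  | smul a x _ hx => rw [smul_comm]; exact Submodule.smul_mem _ a hx

end SuperTensor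

theorem stdBasis_mem (R : SuperCommAlg) (i : SuperIndex) :
    stdBasis R i ∈ superTensor R.grading stdGrading i.parity := by
  refine one_tmul_mem_superTensor ?_
  simp [stdGrading, Finsupp.single_mem_supported]

theorem linearMap_even_of_basis {R : SuperCommAlg} (F : (R ⊗[ℚ] StdSpace) →ₗ[R] R ⊗[ℚ] StdSpace)
    (hF : ∀ i, F (stdBasis R i) ∈ superTensor R.grading stdGrading i.parity) (k : ZMod 2)
    (x : R ⊗[ℚ] StdSpace) (hx : x ∈ superTensor R.grading stdGrading k) :
    F x ∈ superTensor R.grading stdGrading k := by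
  induction hx using Submodule.span_induction with
  | mem x h =>
    obtain ⟨i, j, hij, r, hr, w, hw, rfl⟩ := h
    have : r ⊗ₜ[ℚ] w = ∑ a ∈ w.support, w a • (r • stdBasis R a) := by
      conv_lhs => rw [← Finsupp.sum_single w, Finsupp.sum, TensorProduct.tmul_sum]
      refine Finset.sum_congr rfl fun a _ => ?_
      rw [stdBasis, TensorProduct.smul_tmul', smul_eq_mul, mul_one, ← TensorProduct.tmul_smul,
        Finsupp.smul_single, smul_eq_mul, mul_one]
    rw [this, map_sum]
    refine Submodule.sum_mem _ fun a ha => ?_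
    rw [LinearMap.map_smul_of_tower, map_smul]
    have hp : a.parity = j := hw ha
    have := smul_mem_superTensor hr (hF a)
    rw [hp, hij] at this
    exact Submodule.smul_mem _ _ this
  | zero => simp
  | add x y _ _ hx hy => rw [map_add]; exact add_mem hx hy
  | smul a x _ hx => rw [LinearMap.map_smul_of_tower]; exact Submodule.smul_mem _ a hx

/-! ### Triangular automorphisms. -/

section Triangular

variable (R : SuperCommAlg) (D : Set SuperIndex) (t : ℚ) (f : SuperIndex → R ⊗[ℚ] StdSpace)

open Classical in
/-- The endomorphism which sends `e_i` to `t e_i + f i` for `i ∈ D` and fixes the other basis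
vectors. -/
noncomputable def triangularMap : (R ⊗[ℚ] StdSpace) →ₗ[R] R ⊗[ℚ] StdSpace :=
  -- `R` need not be commutative, so the equivalence behind `constr` is taken linear over `ℕ`.
  (stdBasisBasis R).constr ℕ fun i => if i ∈ D then t • stdBasis R i + f i else stdBasis R i

variable {D} in
theorem triangularMap_of_mem {i : SuperIndex} (hi : i ∈ D) :
    triangularMap R D t f (stdBasis R i) = t • stdBasis R i + f i := by
  rw [triangularMap, ← stdBasisBasis_apply, Module.Basis.constr_basis, if_pos hi, stdBasisBasis_apply]

variable {D} in
theorem triangularMap_of_notMem {i : SuperIndex} (hi : i ∉ D) :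
    triangularMap R D t f (stdBasis R i) = stdBasis R i := by
  rw [triangularMap, ← stdBasisBasis_apply, Module.Basis.constr_basis, if_neg hi, stdBasisBasis_apply]

theorem triangularMap_of_mem_span {z : R ⊗[ℚ] StdSpace}
    (hz : z ∈ Submodule.span R (stdBasis R '' Dᶜ)) : triangularMap R D t f z = z := by
  induction hz using Submodule.span_induction with
  | mem x h =>
    obtain ⟨i, hi, rfl⟩ := h
    exact triangularMap_of_notMem R t f hi
  | zero => simp
  | add x y _ _ hx hy => rw [map_add, hx, hy]
  | smul a x _ hx => rw [map_smul, hx]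

-- The vectors `f i` are fixed, being spanned by basis vectors outside `D`; solving for e_i shows
-- that the inverse has the same triangular shape.
variable {t f} in
theorem triangularMap_comp (ht : t ≠ 0)
    (hf : ∀ i ∈ D, f i ∈ Submodule.span R (stdBasis R '' Dᶜ)) :
    triangularMap R D t f ∘ₗ triangularMap R D t⁻¹ (fun i => -(t⁻¹ • f i)) = LinearMap.id := by
  refine (stdBasisBasis R).ext fun i => ?_
  rw [stdBasisBasis_apply, LinearMap.comp_apply, LinearMap.id_apply]
  by_cases hi : i ∈ D
  · rw [triangularMap_of_mem _ _ _ hi, map_add, map_neg, LinearMap.map_smul_of_tower,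
      LinearMap.map_smul_of_tower, triangularMap_of_mem _ _ _ hi,
      triangularMap_of_mem_span _ _ _ _ (hf i hi), smul_add, smul_smul, inv_mul_cancel₀ ht, one_smul]
    abel
  · rw [triangularMap_of_notMem _ _ _ hi, triangularMap_of_notMem _ _ _ hi]

variable {t f} in
theorem triangularMap_comp' (ht : t ≠ 0)
    (hf : ∀ i ∈ D, f i ∈ Submodule.span R (stdBasis R '' Dᶜ)) :
    triangularMap R D t⁻¹ (fun i => -(t⁻¹ • f i)) ∘ₗ triangularMap R D t f = LinearMap.id := by
  have := triangularMap_comp R D (t := t⁻¹) (f := fun i => -(t⁻¹ • f i)) (inv_ne_zero ht)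
    fun i hi => neg_mem (Submodule.smul_of_tower_mem _ _ (hf i hi))
  simpa [smul_smul, mul_inv_cancel₀ ht] using this

variable {D t f} in
/-- The point of `GL_{∞|∞}` which sends `e_i` to `t e_i + f i` for `i ∈ D` and fixes the other basis
vectors, where `f i` does not involve basis vectors in `D`. -/
noncomputable def triangular (hD : D.Finite) (ht : t ≠ 0)
    (hf : ∀ i ∈ D, f i ∈ Submodule.span R (stdBasis R '' Dᶜ))
    (hp : ∀ i ∈ D, f i ∈ superTensor R.grading stdGrading i.parity) : superGL R where
  val := LinearEquiv.ofLinearMap _ _ (triangularMap_comp R D ht hf) (triangularMap_comp' R D ht hf)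
  property := by
    refine ⟨linearMap_even_of_basis (triangularMap R D t f) fun i => ?_,
      linearMap_even_of_basis (triangularMap R D t⁻¹ (fun i => -(t⁻¹ • f i))) fun i => ?_,
      hD.subset fun i hi => ?_⟩
    · by_cases hi : i ∈ D
      · rw [triangularMap_of_mem _ _ _ hi]
        exact add_mem (Submodule.smul_mem _ _ (stdBasis_mem R i)) (hp i hi)
      · rw [triangularMap_of_notMem _ _ _ hi]
        exact stdBasis_mem R i
    · by_cases hi : i ∈ D
      · rw [triangularMap_of_mem _ _ _ hi]
        exact add_mem (Submodule.smul_mem _ _ (stdBasis_mem R i))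
          (neg_mem (Submodule.smul_mem _ _ (hp i hi)))
      · rw [triangularMap_of_notMem _ _ _ hi]
        exact stdBasis_mem R i
    · by_contra h
      exact hi (triangularMap_of_notMem R t f h)

variable {R D t f} {hD : D.Finite} {ht : t ≠ 0}
  {hf : ∀ i ∈ D, f i ∈ Submodule.span R (stdBasis R '' Dᶜ)}
  {hp : ∀ i ∈ D, f i ∈ superTensor R.grading stdGrading i.parity}

theorem triangular_of_mem {i : SuperIndex} (hi : i ∈ D) :
    (triangular R hD ht hf hp).1 (stdBasis R i) = t • stdBasis R i + f i :=
  triangularMap_of_mem R t f hi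

theorem triangular_of_notMem {i : SuperIndex} (hi : i ∉ D) :
    (triangular R hD ht hf hp).1 (stdBasis R i) = stdBasis R i :=
  triangularMap_of_notMem R t f hi

end Triangular

/-! ### Shears and shifts of blocks of basis vectors. -/

section Shear

variable (R : SuperCommAlg) {L M K : ℕ} (h : L + K ≤ M ∨ M + K ≤ L)

/-- The point of `GL_{∞|∞}` which sends `e_{L+n}` to `e_{L+n} + c e_{M+n}` for `n < K`, and fixes the
other basis vectors. -/
noncomputable def shear (c : ℚ) : superGL R :=
  triangular R (D := block L K) (t := 1)
    (f := fun i => c • stdBasis R (i.withIdx (i.idx - L + M)))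
    (block_finite L K) one_ne_zero
    (fun i hi => Submodule.smul_of_tower_mem _ c (Submodule.subset_span
      ⟨_, fun h' => by
        simp only [block, Set.mem_ofPred_eq, idx_withIdx] at hi h'
        omega, rfl⟩))
    (fun i _ => Submodule.smul_mem _ c (by
      simpa using stdBasis_mem R (i.withIdx (i.idx - L + M))))

variable {R} {c : ℚ} {i : SuperIndex}

theorem shear_of_mem (hi : i ∈ block L K) :
    (shear R h c).1 (stdBasis R i) =
      stdBasis R i + c • stdBasis R (i.withIdx (i.idx - L + M)) := by
  rw [shear, triangular_of_mem hi, one_smul]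

theorem shear_of_notMem (hi : i ∉ block L K) :
    (shear R h c).1 (stdBasis R i) = stdBasis R i :=
  triangular_of_notMem hi

variable (R) in
/-- A point of `GL_{∞|∞}` which sends `e_{L+n}` to `e_{M+n}` for `n < K`, and fixes the basis vectors
with positions outside `[L, L + K)` and `[M, M + K)`. -/
noncomputable def shift : superGL R := shear R h.symm (-1) * shear R h 1

theorem shift_of_mem (hi : i ∈ block L K) :
    (shift R h).1 (stdBasis R i) = stdBasis R (i.withIdx (i.idx - L + M)) := by
  have hi' := hi
  simp only [block, Set.mem_ofPred_eq] at hi'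
  -- With n the offset in the block: e_{L+n} ↦ e_{L+n} + e_{M+n} ↦ e_{L+n} + (e_{M+n} − e_{L+n}).
  rw [shift, Subgroup.coe_mul, LinearEquiv.mul_apply, shear_of_mem h hi, map_add, one_smul,
    shear_of_notMem, shear_of_mem]
  · simp only [withIdx_withIdx, idx_withIdx, Nat.add_sub_cancel, Nat.sub_add_cancel hi'.1,
      withIdx_idx]
    module
  · simp only [block, Set.mem_ofPred_eq, idx_withIdx]
    omega
  · simp only [block, Set.mem_ofPred_eq]
    omega

theorem shift_of_notMem (hi : i ∉ block L K) (hi' : i ∉ block M K) :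
    (shift R h).1 (stdBasis R i) = stdBasis R i := by
  rw [shift, Subgroup.coe_mul, LinearEquiv.mul_apply, shear_of_notMem h hi, shear_of_notMem _ hi']

end Shear

/-! ### Base change of points. -/

section BaseChange

theorem rTensor_smul {R S : SuperCommAlg} (f : R.Hom S) {V : Type*} [AddCommGroup V] [Module ℚ V]
    (r : R) (x : R ⊗[ℚ] V) :
    f.toAlgHom.toLinearMap.rTensor V (r • x) =
      f.toAlgHom r • f.toAlgHom.toLinearMap.rTensor V x := by
  induction x using TensorProduct.induction_on with
  | zero => simp
  | tmul s v => simp [TensorProduct.smul_tmul']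
  | add x y hx hy => rw [smul_add, map_add, map_add, hx, hy, smul_add]

/-- `g'` is the base change of `g` along a homomorphism of superalgebras. -/
def IsBaseChangeOf {R S : SuperCommAlg} (f : R.Hom S) (g : superGL R) (g' : superGL S) : Prop :=
  ∀ x, g'.1 (f.toAlgHom.toLinearMap.rTensor StdSpace x) =
    f.toAlgHom.toLinearMap.rTensor StdSpace (g.1 x)

variable {R S : SuperCommAlg} {f : R.Hom S}

theorem IsBaseChangeOf.mul {g h : superGL R} {g' h' : superGL S} (hg : IsBaseChangeOf f g g')
    (hh : IsBaseChangeOf f h h') : IsBaseChangeOf f (g * h) (g' * h') := fun x => by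
  simp only [Subgroup.coe_mul, LinearEquiv.mul_apply]
  rw [hh, hg]

theorem rTensor_stdBasis (f : R.Hom S) (i : SuperIndex) :
    f.toAlgHom.toLinearMap.rTensor StdSpace (stdBasis R i) = stdBasis S i := by
  simp [stdBasis]

theorem isBaseChangeOf_of_stdBasis {g : superGL R} {g' : superGL S}
    (h : ∀ i, g'.1 (stdBasis S i) =
      f.toAlgHom.toLinearMap.rTensor StdSpace (g.1 (stdBasis R i))) : IsBaseChangeOf f g g' := by
  intro x
  have hx : x ∈ Submodule.span R (Set.range (stdBasisBasis R)) := by simp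
  induction hx using Submodule.span_induction with
  | mem x hx =>
    obtain ⟨i, rfl⟩ := hx
    rw [stdBasisBasis_apply, rTensor_stdBasis, h]
  | zero => simp
  | add x y _ _ hx hy => simp only [map_add, hx, hy]
  | smul r x _ hx => rw [rTensor_smul, map_smul, map_smul, rTensor_smul, hx]

theorem isBaseChangeOf_shear {L M K : ℕ} (h : L + K ≤ M ∨ M + K ≤ L) (c : ℚ) :
    IsBaseChangeOf f (shear R h c) (shear S h c) := by
  refine isBaseChangeOf_of_stdBasis fun i => ?_
  by_cases hi : i ∈ block L K
  · rw [shear_of_mem h hi, shear_of_mem h hi, map_add, map_smul, rTensor_stdBasis,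
      rTensor_stdBasis]
  · rw [shear_of_notMem h hi, shear_of_notMem h hi, rTensor_stdBasis]

theorem isBaseChangeOf_shift {L M K : ℕ} (h : L + K ≤ M ∨ M + K ≤ L) :
    IsBaseChangeOf f (shift R h) (shift S h) :=
  (isBaseChangeOf_shear _ _).mul (isBaseChangeOf_shear _ _)

end BaseChange

/-! ### Polynomial dependence of the action on the group element -/

theorem tensorPowersAct_single_add (R : SuperCommAlg) (g : superGL R) (i : SuperIndex)
    (w : FreeAddMonoid SuperIndex) :
    tensorPowersAct R g (AddMonoidAlgebra.single (FreeAddMonoid.of i + w) 1) =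
      GradedTensorProduct.of ℚ R.grading tensorPowersGrading
        (stdInclusion.lTensor R (g.1 (stdBasis R i))) *
        tensorPowersAct R g (AddMonoidAlgebra.single w 1) := by
  have : (AddMonoidAlgebra.single (FreeAddMonoid.of i + w) 1 : TensorPowers) =
      AddMonoidAlgebra.single (FreeAddMonoid.of i) 1 * AddMonoidAlgebra.single w 1 := by
    rw [AddMonoidAlgebra.single_mul_single, one_mul]
  rw [this, map_mul]
  congr 1
  rw [tensorPowersAct, AddMonoidAlgebra.lift_single, one_smul]
  rfl

/-- A family of points of `GL_{∞|∞}` whose effect on the basis vectors `e_n` with `n < K` depends in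
an affine way on the parameter. -/
def IsAffineFamily (R : SuperCommAlg) (K : ℕ) (G : ℚ → superGL R) : Prop :=
  ∃ u v : SuperIndex → R ⊗[ℚ] StdSpace,
    ∀ t i, i.idx < K → (G t).1 (stdBasis R i) = u i + t • v i

theorem IsAffineFamily.mono {R : SuperCommAlg} {K K' : ℕ} {G : ℚ → superGL R}
    (hG : IsAffineFamily R K' G) (h : K ≤ K') : IsAffineFamily R K G := by
  obtain ⟨u, v, hG⟩ := hG
  exact ⟨u, v, fun t i hi => hG t i (hi.trans_le h)⟩

/-- A word goes to the product of the images of its letters, and each image is affine in t once `K`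
exceeds the position of the letter. The bound `K` depends on the word alone, not on `R` or `G`. -/
theorem exists_polyFun_tensorPowersAct_single (w : FreeAddMonoid SuperIndex) :
    ∃ K : ℕ, ∀ (R : SuperCommAlg) (G : ℚ → superGL R), IsAffineFamily R K G →
      (fun t => tensorPowersAct R (G t) (AddMonoidAlgebra.single w 1)) ∈ polyFun _ := by
  induction w using FreeAddMonoid.inductionOn' with
  | zero =>
    refine ⟨0, fun R G _ => ?_⟩
    have : (AddMonoidAlgebra.single 0 1 : TensorPowers) = 1 := rfl
    simp only [this, map_one]
    exact polyFun_const 1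
  | of_add i w ih =>
    obtain ⟨K, hK⟩ := ih
    refine ⟨max K (i.idx + 1), fun R G hG => ?_⟩
    simp only [tensorPowersAct_single_add]
    refine polyFun_mul ?_ (hK R G (hG.mono (le_max_left _ _)))
    obtain ⟨u, v, hG⟩ := hG
    simp only [hG _ i (lt_of_lt_of_le (Nat.lt_succ_self _) (le_max_right _ _))]
    exact polyFun_map ((GradedTensorProduct.of ℚ R.grading tensorPowersGrading).toLinearMap ∘ₗ
      stdInclusion.lTensor R) (polyFun_affine (u i) (v i))

theorem exists_polyFun_tensorPowersAct (x : TensorPowers) :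
    ∃ K : ℕ, ∀ (R : SuperCommAlg) (G : ℚ → superGL R), IsAffineFamily R K G →
      (fun t => tensorPowersAct R (G t) x) ∈ polyFun _ := by
  induction x using AddMonoidAlgebra.induction_linear with
  | zero =>
    refine ⟨0, fun R G _ => ?_⟩
    simp only [map_zero]
    exact zero_mem (polyFun _)
  | add x y hx hy =>
    obtain ⟨K, hK⟩ := hx
    obtain ⟨K', hK'⟩ := hy
    refine ⟨max K K', fun R G hG => ?_⟩
    simp only [map_add]
    exact add_mem (hK R G (hG.mono (le_max_left _ _))) (hK' R G (hG.mono (le_max_right _ _)))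
  | single w r =>
    obtain ⟨K, hK⟩ := exists_polyFun_tensorPowersAct_single w
    refine ⟨K, fun R G hG => ?_⟩
    have : (AddMonoidAlgebra.single w r : TensorPowers) = r • AddMonoidAlgebra.single w 1 := by
      simp
    simp only [this, map_smul]
    exact Submodule.smul_mem _ r (hK R G hG)

theorem exists_polyFun_sumTensorPowersAct {κ : Type u} (x : κ →₀ TensorPowers) :
    ∃ K : ℕ, ∀ (R : SuperCommAlg) (G : ℚ → superGL R), IsAffineFamily R K G →
      (fun t => sumTensorPowersAct κ R (G t) x) ∈ polyFun _ := by
  induction x using Finsupp.induction_linear with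
  | zero =>
    refine ⟨0, fun R G _ => ?_⟩
    simp only [map_zero]
    exact zero_mem (polyFun _)
  | add x y hx hy =>
    obtain ⟨K, hK⟩ := hx
    obtain ⟨K', hK'⟩ := hy
    refine ⟨max K K', fun R G hG => ?_⟩
    simp only [map_add]
    exact add_mem (hK R G (hG.mono (le_max_left _ _))) (hK' R G (hG.mono (le_max_right _ _)))
  | single c x =>
    obtain ⟨K, hK⟩ := exists_polyFun_tensorPowersAct x
    refine ⟨K, fun R G hG => ?_⟩
    simp only [sumTensorPowersAct, Finsupp.lsum_single]
    exact polyFun_map ((Finsupp.lsingle (R := ℚ) c).lTensor R ∘ₗ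
      (GradedTensorProduct.of ℚ R.grading tensorPowersGrading).symm.toLinearMap) (hK R G hG)

/-! ### Elements of a polynomial representation involve finitely many basis vectors. -/

namespace SuperGLRep

variable {V : Type u} [AddCommGroup V] [Module ℚ V] {𝒱 : ZMod 2 → Submodule ℚ V}

/-- The action on `a` depends polynomially on the values of the group element at the basis vectors
`e_n` with `n < K`. -/
def HasBound (ρ : SuperGLRep 𝒱) (K : ℕ) (a : V) : Prop :=
  ∀ (R : SuperCommAlg) (G : ℚ → superGL R), IsAffineFamily R K G →
    (fun t => ρ.act R (G t) (1 ⊗ₜ[ℚ] a)) ∈ polyFun (R ⊗[ℚ] V)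

variable {ρ : SuperGLRep 𝒱}

theorem HasBound.mono {K K' : ℕ} {a : V} (ha : ρ.HasBound K a) (h : K ≤ K') : ρ.HasBound K' a :=
  fun R G hG => ha R G (hG.mono h)

theorem IsPolynomial.exists_hasBound (hρ : ρ.IsPolynomial) (a : V) : ∃ K, ρ.HasBound K a := by
  obtain ⟨κ, N, φ, -, -, hsurj, hact⟩ := hρ
  obtain ⟨n, rfl⟩ := hsurj a
  -- The extension need not be equivariant. It expresses the action through one linear map
  -- independent of t, where `hact` provides a separate `z` for each t.
  obtain ⟨ψ, hψ⟩ := LinearMap.exists_extend φ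
  obtain ⟨K, hK⟩ := exists_polyFun_sumTensorPowersAct n.1
  refine ⟨K, fun R G hG => ?_⟩
  have h (t : ℚ) : ρ.act R (G t) (1 ⊗ₜ[ℚ] φ n) =
      ψ.lTensor R (sumTensorPowersAct κ R (G t) n.1) := by
    obtain ⟨z, hz, hz'⟩ := hact R (G t) n
    rw [← hz', ← hz, ← hψ, LinearMap.lTensor_comp, LinearMap.comp_apply]
  simp only [h]
  exact polyFun_map _ (hK R G hG)

/-- The family equal to `g` at 0 and to `h` elsewhere is constant on the relevant basis vectors,
hence affine; the resulting polynomial function is constant away from 0, so also at 0. -/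
theorem HasBound.act_eq {K : ℕ} {a : V} (ha : ρ.HasBound K a) {R : SuperCommAlg}
    {g h : superGL R} (hgh : ∀ i : SuperIndex, i.idx < K → g.1 (stdBasis R i) = h.1 (stdBasis R i)) :
    ρ.act R g (1 ⊗ₜ[ℚ] a) = ρ.act R h (1 ⊗ₜ[ℚ] a) := by
  have := polyFun_eq_of_ne_zero (ha R (fun t => if t = 0 then g else h)
    ⟨fun i => h.1 (stdBasis R i), 0, fun t i hi => ?_⟩) (ρ.act R h (1 ⊗ₜ[ℚ] a))
    fun t ht => by rw [if_neg ht]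
  · simpa using this
  · beta_reduce
    split_ifs
    · simp [hgh i hi]
    · simp

theorem HasBound.act_eq_self {K : ℕ} {a : V} (ha : ρ.HasBound K a) {R : SuperCommAlg}
    {g : superGL R} (hg : ∀ i : SuperIndex, i.idx < K → g.1 (stdBasis R i) = stdBasis R i) :
    ρ.act R g (1 ⊗ₜ[ℚ] a) = 1 ⊗ₜ[ℚ] a := by
  rw [ha.act_eq (h := 1) hg, map_one, Module.End.one_apply]

end SuperGLRep

/-! ### Coefficients of tensors -/

section Coeff

variable {R V : Type*} [AddCommGroup R] [Module ℚ R] [AddCommGroup V] [Module ℚ V]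

/-- The contraction `R ⊗ V → V` with a linear form on `R`. -/
noncomputable def coeff (l : R →ₗ[ℚ] ℚ) : R ⊗[ℚ] V →ₗ[ℚ] V :=
  (TensorProduct.lid ℚ V).toLinearMap ∘ₗ l.rTensor V

@[simp] theorem coeff_tmul (l : R →ₗ[ℚ] ℚ) (r : R) (v : V) : coeff l (r ⊗ₜ[ℚ] v) = l r • v := by
  simp [coeff]

theorem coeff_mem {l : R →ₗ[ℚ] ℚ} {W : Submodule ℚ V} {z : R ⊗[ℚ] V}
    (hz : z ∈ LinearMap.range (W.subtype.lTensor R)) : coeff l z ∈ W := by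
  obtain ⟨y, rfl⟩ := hz
  induction y using TensorProduct.induction_on with
  | zero => simp
  | tmul r w => simpa using W.smul_mem _ w.2
  | add x y hx hy => simpa only [map_add] using add_mem hx hy

theorem tmul_mem_range_lTensor {W : Submodule ℚ V} (r : R) {w : V} (hw : w ∈ W) :
    r ⊗ₜ[ℚ] w ∈ LinearMap.range (W.subtype.lTensor R) :=
  ⟨r ⊗ₜ ⟨w, hw⟩, by simp⟩

/-- A tensor whose coefficients lie in `W` lies in `R ⊗ W`. -/
theorem mem_range_lTensor_of_coeff_mem {W : Submodule ℚ V} {z : R ⊗[ℚ] V}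
    (h : ∀ l : R →ₗ[ℚ] ℚ, coeff l z ∈ W) : z ∈ LinearMap.range (W.subtype.lTensor R) := by
  classical
  let b := Module.Basis.ofVectorSpace ℚ R
  -- Allowing every larger index set lets the expansions of two tensors be added over a common one.
  have key (z : R ⊗[ℚ] V) : ∃ s, ∀ s', s ⊆ s' → z = ∑ i ∈ s', b i ⊗ₜ[ℚ] coeff (b.coord i) z := by
    induction z using TensorProduct.induction_on with
    | zero => exact ⟨∅, by simp⟩
    | tmul r v =>
      refine ⟨(b.repr r).support, fun s' hs' => ?_⟩
      have hr : r = ∑ i ∈ s', b.repr r i • b i := by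
        conv_lhs => rw [← b.linearCombination_repr r, Finsupp.linearCombination_apply]
        exact Finsupp.sum_of_support_subset _ hs' _ (by simp)
      conv_lhs => rw [hr, TensorProduct.sum_tmul]
      simp [TensorProduct.smul_tmul]
    | add x y hx hy =>
      obtain ⟨s, hs⟩ := hx
      obtain ⟨t, ht⟩ := hy
      refine ⟨s ∪ t, fun s' hs' => ?_⟩
      simp only [map_add, TensorProduct.tmul_add, Finset.sum_add_distrib]
      rw [← hs s' (Finset.union_subset_left hs'), ← ht s' (Finset.union_subset_right hs')]
  obtain ⟨s, hs⟩ := key z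
  rw [hs s subset_rfl]
  exact Submodule.sum_mem _ fun i _ => tmul_mem_range_lTensor _ (h _)

end Coeff

/-! ### Rational points -/

/-- The rational numbers, in even degree. -/
def ratGrading (i : ZMod 2) : Submodule ℚ ℚ := if i = 0 then ⊤ else ⊥

theorem mem_ratGrading_zero (q : ℚ) : q ∈ ratGrading 0 := by
  simp [ratGrading]

theorem eq_zero_of_mem_ratGrading {i : ZMod 2} (hi : i ≠ 0) {q : ℚ} (hq : q ∈ ratGrading i) :
    q = 0 := by
  simpa [ratGrading, hi] using hq

instance : GradedAlgebra ratGrading where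
  one_mem := mem_ratGrading_zero 1
  mul_mem i j a b ha hb := by
    by_cases hi : i = 0
    · by_cases hj : j = 0
      · subst hi hj
        exact mem_ratGrading_zero _
      · simp [eq_zero_of_mem_ratGrading hj hb]
    · simp [eq_zero_of_mem_ratGrading hi ha]
  decompose' q := DirectSum.of (fun i => ratGrading i) 0 ⟨q, mem_ratGrading_zero q⟩
  left_inv q := by simp
  right_inv x := by
    induction x using DirectSum.induction_on with
    | zero =>
      simp only [map_zero]
      exact map_zero (DirectSum.of (fun i => ratGrading i) 0)
    | of i x =>
      by_cases hi : i = 0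
      · subst hi
        simp
      · have : x = 0 := Subtype.ext (eq_zero_of_mem_ratGrading hi x.2)
        simp only [this, map_zero]
        exact map_zero (DirectSum.of (fun i => ratGrading i) 0)
    | add x y hx hy =>
      conv_rhs => rw [← hx, ← hy]
      rw [← map_add, map_add]
      rfl

/-- The superalgebra `ℚ`. -/
abbrev ratAlg : SuperCommAlg where
  carrier := ℚ
  grading := ratGrading
  supercomm i j a b ha hb := by
    by_cases hi : i = 0
    · simp [hi, mul_comm]
    · simp [eq_zero_of_mem_ratGrading hi ha]

/-- The unique homomorphism from `ℚ` to a superalgebra. -/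
def ratAlgHom (R : SuperCommAlg) : ratAlg.Hom R where
  toAlgHom := Algebra.ofId ℚ R
  map_grading i x hx := by
    by_cases hi : i = 0
    · subst hi
      exact SetLike.algebraMap_mem_graded R.grading x
    · rw [eq_zero_of_mem_ratGrading hi hx, map_zero]
      exact zero_mem _

theorem one_tmul_coeff_id {V : Type*} [AddCommGroup V] [Module ℚ V] (z : ratAlg ⊗[ℚ] V) :
    (1 : ratAlg) ⊗ₜ[ℚ] coeff (LinearMap.id : ratAlg →ₗ[ℚ] ℚ) z = z := by
  induction z using TensorProduct.induction_on with
  | zero => simp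
  | tmul r v =>
    rw [coeff_tmul, ← TensorProduct.smul_tmul]
    simp
  | add x y hx hy => rw [map_add, TensorProduct.tmul_add, hx, hy]

theorem coeff_superTensor_ratGrading {V : Type*} [AddCommGroup V] [Module ℚ V]
    {𝒱 : ZMod 2 → Submodule ℚ V} {k : ZMod 2} {z : ratAlg ⊗[ℚ] V}
    (hz : z ∈ superTensor ratGrading 𝒱 k) (l : ratAlg →ₗ[ℚ] ℚ) : coeff l z ∈ 𝒱 k := by
  induction hz using Submodule.span_induction with
  | mem x h =>
    obtain ⟨i, j, hij, q, hq, v, hv, rfl⟩ := h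
    by_cases hi : i = 0
    · rw [hi, zero_add] at hij
      subst hij
      rw [coeff_tmul]
      exact Submodule.smul_mem _ _ hv
    · rw [eq_zero_of_mem_ratGrading hi hq]
      simp
  | zero => simp
  | add x y _ _ hx hy => rw [map_add]; exact add_mem hx hy
  | smul a x _ hx => rw [map_smul]; exact Submodule.smul_mem _ a hx

theorem range_lTensor_smul_mem {R : SuperCommAlg} {V : Type*} [AddCommGroup V] [Module ℚ V]
    {W : Submodule ℚ V} (r : R) {z : R ⊗[ℚ] V} (hz : z ∈ LinearMap.range (W.subtype.lTensor R)) :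
    r • z ∈ LinearMap.range (W.subtype.lTensor R) := by
  obtain ⟨y, rfl⟩ := hz
  induction y using TensorProduct.induction_on with
  | zero => simp
  | tmul s w =>
    rw [LinearMap.lTensor_tmul, TensorProduct.smul_tmul']
    exact tmul_mem_range_lTensor _ w.2
  | add x y hx hy => rw [map_add, smul_add]; exact add_mem hx hy

theorem SuperGLRep.IsSubrep.act_mem {V : Type u} [AddCommGroup V] [Module ℚ V]
    {𝒱 : ZMod 2 → Submodule ℚ V} {ρ : SuperGLRep 𝒱} {W : Submodule ℚ V} (hW : ρ.IsSubrep W)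
    {R : SuperCommAlg} (g : superGL R) {z : R ⊗[ℚ] V}
    (hz : z ∈ LinearMap.range (W.subtype.lTensor R)) :
    ρ.act R g z ∈ LinearMap.range (W.subtype.lTensor R) := by
  obtain ⟨y, rfl⟩ := hz
  induction y using TensorProduct.induction_on with
  | zero => simp
  | tmul r w =>
    have : W.subtype.lTensor R (r ⊗ₜ w) = r • ((1 : R) ⊗ₜ[ℚ] (w : V)) := by
      simp [TensorProduct.smul_tmul']
    rw [this, map_smul]
    exact range_lTensor_smul_mem r (hW.stable R g w w.2)
  | add x y hx hy => rw [map_add, map_add]; exact add_mem hx hy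

/-! ### The action on the elements of a twisted commutative algebra -/

section GradedTensorProduct

variable {A : Type u} [Ring A] [Algebra ℚ A] {𝒜 : ZMod 2 → Submodule ℚ A} [GradedAlgebra 𝒜]
  {R : SuperCommAlg}

theorem one_tmul_mul_one_tmul (a b : A) :
    GradedTensorProduct.of ℚ R.grading 𝒜 (1 ⊗ₜ[ℚ] a) *
      GradedTensorProduct.of ℚ R.grading 𝒜 (1 ⊗ₜ[ℚ] b) =
    GradedTensorProduct.of ℚ R.grading 𝒜 (1 ⊗ₜ[ℚ] (a * b)) :=
  (map_mul (GradedTensorProduct.includeRight R.grading 𝒜) a b).symm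

theorem tmul_mul_one_tmul (r : R) (a b : A) :
    GradedTensorProduct.of ℚ R.grading 𝒜 (r ⊗ₜ[ℚ] a) *
      GradedTensorProduct.of ℚ R.grading 𝒜 (1 ⊗ₜ[ℚ] b) =
    GradedTensorProduct.of ℚ R.grading 𝒜 (r ⊗ₜ[ℚ] (a * b)) := by
  have h (c : A) : GradedTensorProduct.of ℚ R.grading 𝒜 (r ⊗ₜ[ℚ] c) =
      GradedTensorProduct.of ℚ R.grading 𝒜 (r ⊗ₜ[ℚ] 1) *
        GradedTensorProduct.of ℚ R.grading 𝒜 (1 ⊗ₜ[ℚ] c) :=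
    (GradedTensorProduct.tmul_one_mul_one_tmul R.grading 𝒜 r c).symm
  rw [h a, mul_assoc, one_tmul_mul_one_tmul, ← h]

theorem one_tmul_mul_tmul {i j : ZMod 2} {a : A} (ha : a ∈ 𝒜 i) {r : R} (hr : r ∈ R.grading j)
    (b : A) :
    GradedTensorProduct.of ℚ R.grading 𝒜 (1 ⊗ₜ[ℚ] a) *
      GradedTensorProduct.of ℚ R.grading 𝒜 (r ⊗ₜ[ℚ] b) =
    (-1 : ℤˣ) ^ (i * j) • GradedTensorProduct.of ℚ R.grading 𝒜 (r ⊗ₜ[ℚ] (a * b)) := by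
  have := GradedTensorProduct.tmul_coe_mul_coe_tmul (R := ℚ) R.grading 𝒜 1 ⟨a, ha⟩ ⟨r, hr⟩ b
  rw [one_mul] at this
  exact this

/-- Moving an even `a` past elements of `R` costs no Koszul sign, so only the second tensor factor
is affected. -/
theorem even_one_tmul_mul {a : A} (ha : a ∈ 𝒜 0) (z : R ⊗[ℚ] A) :
    GradedTensorProduct.of ℚ R.grading 𝒜 (1 ⊗ₜ[ℚ] a) * GradedTensorProduct.of ℚ R.grading 𝒜 z =
      GradedTensorProduct.of ℚ R.grading 𝒜 ((LinearMap.mulLeft ℚ a).lTensor R z) := by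
  induction z using TensorProduct.induction_on with
  | zero => simp
  | tmul r b =>
    induction r using DirectSum.Decomposition.inductionOn R.grading with
    | zero => simp
    | homogeneous r =>
      rw [one_tmul_mul_tmul ha r.2]
      simp
    | add r s hr hs => rw [TensorProduct.add_tmul, map_add, mul_add, hr, hs, map_add, map_add]
  | add x y hx hy => rw [map_add, mul_add, hx, hy, map_add, map_add]

theorem coeff_lTensor_mulLeft (l : R →ₗ[ℚ] ℚ) (a : A) (z : R ⊗[ℚ] A) :
    coeff l ((LinearMap.mulLeft ℚ a).lTensor R z) = a * coeff l z := by
  induction z using TensorProduct.induction_on with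
  | zero => simp
  | tmul r b => simp
  | add x y hx hy => rw [map_add, map_add, hx, hy, map_add, mul_add]

end GradedTensorProduct

namespace SuperTCA

variable {A : Type u} [Ring A] [Algebra ℚ A] {𝒜 : ZMod 2 → Submodule ℚ A} [GradedAlgebra 𝒜]
  (T : SuperTCA 𝒜)

theorem act_one_tmul_mul (R : SuperCommAlg) (g : superGL R) (a b : A) :
    GradedTensorProduct.of ℚ R.grading 𝒜 (T.act R g (1 ⊗ₜ[ℚ] (a * b))) =
      GradedTensorProduct.of ℚ R.grading 𝒜 (T.act R g (1 ⊗ₜ[ℚ] a)) *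
        GradedTensorProduct.of ℚ R.grading 𝒜 (T.act R g (1 ⊗ₜ[ℚ] b)) := by
  have := T.act_mul R g (GradedTensorProduct.of ℚ R.grading 𝒜 (1 ⊗ₜ[ℚ] a))
    (GradedTensorProduct.of ℚ R.grading 𝒜 (1 ⊗ₜ[ℚ] b))
  rwa [one_tmul_mul_one_tmul] at this

variable {T}

theorem hasBound_one : T.HasBound 0 1 := fun R G _ => by
  simp only [T.act_one]
  exact polyFun_const _

theorem HasBound.mul {K : ℕ} {a b : A} (ha : T.HasBound K a) (hb : T.HasBound K b) :
    T.HasBound K (a * b) := fun R G hG => by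
  have h := polyFun_mul
    (polyFun_map (GradedTensorProduct.of ℚ R.grading 𝒜).toLinearMap (ha R G hG))
    (polyFun_map (GradedTensorProduct.of ℚ R.grading 𝒜).toLinearMap (hb R G hG))
  have h' := polyFun_map (GradedTensorProduct.of ℚ R.grading 𝒜).symm.toLinearMap h
  simp only [LinearEquiv.coe_coe, ← act_one_tmul_mul, GradedTensorProduct.of_symm_of] at h'
  exact h'

theorem HasBound.pow {K : ℕ} {a : A} (ha : T.HasBound K a) (n : ℕ) : T.HasBound K (a ^ n) := by
  induction n with
  | zero => simpa using hasBound_one.mono (Nat.zero_le K)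
  | succ n ih => rw [pow_succ]; exact HasBound.mul ih ha

variable (T) in
/-- The action of a rational point of `GL_{∞|∞}` on a twisted commutative algebra. -/
noncomputable def ratAct (g : superGL ratAlg) : A →ₐ[ℚ] A :=
  AlgHom.ofLinearMap
    (coeff (LinearMap.id : ratAlg →ₗ[ℚ] ℚ) ∘ₗ (T.act ratAlg g).restrictScalars ℚ ∘ₗ
      TensorProduct.mk ℚ ratAlg A 1)
    (by
      simp [T.act_one])
    (fun a b => by
      have h (c : A) : (coeff (LinearMap.id : ratAlg →ₗ[ℚ] ℚ) ∘ₗ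
          (T.act ratAlg g).restrictScalars ℚ ∘ₗ TensorProduct.mk ℚ ratAlg A 1) c =
          coeff (LinearMap.id : ratAlg →ₗ[ℚ] ℚ) (T.act ratAlg g (1 ⊗ₜ[ℚ] c)) := rfl
      have := T.act_one_tmul_mul ratAlg g a b
      rw [← one_tmul_coeff_id (T.act ratAlg g (1 ⊗ₜ[ℚ] a)),
        ← one_tmul_coeff_id (T.act ratAlg g (1 ⊗ₜ[ℚ] b)), one_tmul_mul_one_tmul] at this
      rw [h, h, h, (GradedTensorProduct.of ℚ ratAlg.grading 𝒜).injective this, coeff_tmul]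
      simp)

theorem ratAct_apply (g : superGL ratAlg) (a : A) :
    T.ratAct g a = coeff (LinearMap.id : ratAlg →ₗ[ℚ] ℚ) (T.act ratAlg g (1 ⊗ₜ[ℚ] a)) := rfl

theorem one_tmul_ratAct (g : superGL ratAlg) (a : A) :
    (1 : ratAlg) ⊗ₜ[ℚ] T.ratAct g a = T.act ratAlg g (1 ⊗ₜ[ℚ] a) := one_tmul_coeff_id _

theorem ratAct_mem {k : ZMod 2} (g : superGL ratAlg) {a : A} (ha : a ∈ 𝒜 k) :
    T.ratAct g a ∈ 𝒜 k :=
  coeff_superTensor_ratGrading (T.act_even ratAlg g k _ (one_tmul_mem_superTensor ha)) _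

theorem ratAct_mem_subrep {W : Submodule ℚ A} (hW : T.IsSubrep W) (g : superGL ratAlg) {a : A}
    (ha : a ∈ W) : T.ratAct g a ∈ W :=
  coeff_mem (hW.stable ratAlg g a ha)

theorem ratAct_mul (g h : superGL ratAlg) (a : A) :
    T.ratAct (g * h) a = T.ratAct g (T.ratAct h a) := by
  rw [ratAct_apply, ratAct_apply, one_tmul_ratAct, map_mul, Module.End.mul_apply]

theorem polyFun_ratAct {K : ℕ} {a : A} (ha : T.HasBound K a) {G : ℚ → superGL ratAlg}
    (hG : IsAffineFamily ratAlg K G) : (fun t => T.ratAct (G t) a) ∈ polyFun A :=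
  polyFun_map (coeff (LinearMap.id : ratAlg →ₗ[ℚ] ℚ)) (ha ratAlg G hG)

/-- The action of the base change of a rational point. -/
theorem act_baseChange {R : SuperCommAlg} {g : superGL ratAlg} {g' : superGL R}
    (h : IsBaseChangeOf (ratAlgHom R) g g') (a : A) :
    T.act R g' (1 ⊗ₜ[ℚ] a) = 1 ⊗ₜ[ℚ] T.ratAct g a := by
  have := T.act_natural ratAlg R (ratAlgHom R) g g' h (1 ⊗ₜ[ℚ] a)
  rw [← one_tmul_ratAct] at this
  simpa using this

end SuperTCA

/-! ### Super subspaces of a superalgebra -/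

section SuperSubspace

variable {A : Type u} [Ring A] [Algebra ℚ A] {𝒜 : ZMod 2 → Submodule ℚ A} [GradedAlgebra 𝒜]

theorem sum_proj (a : A) : ∑ i, GradedAlgebra.proj 𝒜 i a = a := by
  classical
  conv_rhs => rw [← DirectSum.sum_support_decompose 𝒜 a]
  refine (Finset.sum_subset (Finset.subset_univ _) fun i _ hi => ?_).symm
  simpa using hi

theorem proj_of_mem {i : ZMod 2} {a : A} (ha : a ∈ 𝒜 i) : GradedAlgebra.proj 𝒜 i a = a := by
  rw [GradedAlgebra.proj_apply, DirectSum.decompose_of_mem_same 𝒜 ha]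

theorem proj_of_mem_ne {i j : ZMod 2} {a : A} (ha : a ∈ 𝒜 i) (h : i ≠ j) :
    GradedAlgebra.proj 𝒜 j a = 0 := by
  rw [GradedAlgebra.proj_apply, DirectSum.decompose_of_mem_ne 𝒜 ha h]

theorem proj_mem (i : ZMod 2) (a : A) : GradedAlgebra.proj 𝒜 i a ∈ 𝒜 i := by
  rw [GradedAlgebra.proj_apply]
  exact SetLike.coe_mem _

theorem IsSuperSubspace.proj_mem {W : Submodule ℚ A} (hW : IsSuperSubspace 𝒜 W) (i : ZMod 2)
    {a : A} (ha : a ∈ W) : GradedAlgebra.proj 𝒜 i a ∈ W := by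
  replace ha := hW ha
  induction ha using Submodule.iSup_induction' with
  | mem j x hx =>
    by_cases h : j = i
    · subst h
      rw [proj_of_mem hx.2]
      exact hx.1
    · rw [proj_of_mem_ne hx.2 h]
      exact zero_mem _
  | zero => simp
  | add x y _ _ hx hy => rw [map_add]; exact add_mem hx hy

theorem isSuperSubspace_of_proj_mem {W : Submodule ℚ A}
    (h : ∀ i, ∀ a ∈ W, GradedAlgebra.proj 𝒜 i a ∈ W) : IsSuperSubspace 𝒜 W := by
  intro a ha
  rw [← sum_proj (𝒜 := 𝒜) a]
  exact Submodule.sum_mem _ fun i _ =>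
    Submodule.mem_iSup_of_mem i ⟨h i a ha, _root_.proj_mem i a⟩

/-- In total degree `k`, degree `i` in `A` is paired with degree `k - i` in `R`; projecting a
coefficient therefore only changes the linear form. -/
theorem proj_coeff {R : SuperCommAlg} {k : ZMod 2} {z : R ⊗[ℚ] A}
    (hz : z ∈ superTensor R.grading 𝒜 k) (i : ZMod 2) (l : R →ₗ[ℚ] ℚ) :
    GradedAlgebra.proj 𝒜 i (coeff l z) =
      coeff (l ∘ₗ GradedAlgebra.proj R.grading (k - i)) z := by
  induction hz using Submodule.span_induction with
  | mem x h =>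
    obtain ⟨a, b, rfl, r, hr, v, hv, rfl⟩ := h
    rw [coeff_tmul, coeff_tmul, map_smul, LinearMap.comp_apply]
    by_cases h : b = i
    · subst h
      rw [proj_of_mem hv, add_sub_cancel_right, proj_of_mem hr]
    · rw [proj_of_mem_ne hv h, proj_of_mem_ne hr, map_zero, zero_smul, smul_zero]
      intro h'
      exact h (by rw [eq_sub_iff_add_eq] at h'; exact (add_left_cancel h').symm)
  | zero => simp
  | add x y _ _ hx hy => simp only [map_add, hx, hy]
  | smul a x _ hx => simp only [map_smul, hx]

theorem coeff_mul_one_tmul {R : SuperCommAlg} (l : R →ₗ[ℚ] ℚ) (z : R ⊗[ℚ] A) (a : A) :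
    coeff l ((GradedTensorProduct.of ℚ R.grading 𝒜).symm
      (GradedTensorProduct.of ℚ R.grading 𝒜 z *
        GradedTensorProduct.of ℚ R.grading 𝒜 (1 ⊗ₜ[ℚ] a))) = coeff l z * a := by
  induction z using TensorProduct.induction_on with
  | zero => simp
  | tmul r b => simp [tmul_mul_one_tmul]
  | add x y hx hy => rw [map_add, add_mul, map_add, map_add, hx, hy, map_add, add_mul]

/-- For homogeneous `v`, passing `v` across a homogeneous element of `R` costs only a sign; `hV`
reduces to such `v`. -/
theorem one_tmul_mul_mem {R : SuperCommAlg} {V W U : Submodule ℚ A} (hV : IsSuperSubspace 𝒜 V)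
    (h : ∀ v ∈ V, ∀ w ∈ W, v * w ∈ U) {v : A} (hv : v ∈ V) {z : R ⊗[ℚ] A}
    (hz : z ∈ LinearMap.range (W.subtype.lTensor R)) :
    (GradedTensorProduct.of ℚ R.grading 𝒜).symm
      (GradedTensorProduct.of ℚ R.grading 𝒜 (1 ⊗ₜ[ℚ] v) * GradedTensorProduct.of ℚ R.grading 𝒜 z) ∈
    LinearMap.range (U.subtype.lTensor R) := by
  replace hv := hV hv
  induction hv using Submodule.iSup_induction' with
  | mem i v hv =>
    obtain ⟨y, rfl⟩ := hz
    induction y using TensorProduct.induction_on with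
    | zero => simp
    | tmul r w =>
      rw [LinearMap.lTensor_tmul]
      induction r using DirectSum.Decomposition.inductionOn R.grading with
      | zero => simp
      | @homogeneous j r =>
        rw [one_tmul_mul_tmul hv.2 r.2]
        have := tmul_mem_range_lTensor (r : R) (h v hv.1 _ w.2)
        rcases Int.units_eq_one_or ((-1 : ℤˣ) ^ (i * j)) with h | h <;> rw [h]
        · simpa using this
        · simpa using this
      | add r s hr hs =>
        rw [TensorProduct.add_tmul, map_add, mul_add, map_add]
        exact add_mem hr hs
    | add x y hx hy =>
      rw [map_add, map_add, mul_add, map_add]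
      exact add_mem hx hy
  | zero => simp
  | add x y _ _ hx hy =>
    rw [TensorProduct.tmul_add, map_add, add_mul, map_add]
    exact add_mem hx hy

end SuperSubspace

namespace SuperTCA

variable {A : Type u} [Ring A] [Algebra ℚ A] {𝒜 : ZMod 2 → Submodule ℚ A} [GradedAlgebra 𝒜]
  {T : SuperTCA 𝒜}

/-! ### The colon of two subrepresentations -/

/-- The elements `v` with `v W ⊆ U`. -/
def colon (U W : Submodule ℚ A) : Submodule ℚ A where
  carrier := {v | ∀ w ∈ W, v * w ∈ U}
  add_mem' hx hy w hw := by rw [add_mul]; exact add_mem (hx w hw) (hy w hw)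
  zero_mem' w _ := by rw [zero_mul]; exact zero_mem _
  smul_mem' c x hx w hw := by rw [smul_mul_assoc]; exact U.smul_mem c (hx w hw)

/-- Since g is invertible and acts multiplicatively, (gv)w = g(v · g⁻¹w), and g⁻¹w again has its
coefficients in `W`. -/
theorem isSubrep_colon {U W : Submodule ℚ A} (hU : T.IsSubrep U) (hW : T.IsSubrep W) :
    T.IsSubrep (colon U W) := by
  have hs : IsSuperSubspace 𝒜 (colon U W) := by
    refine isSuperSubspace_of_proj_mem fun i v hv w hw => ?_
    -- For w homogeneous of degree j, the component of vw in degree i + j is v_i w.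
    rw [← sum_proj (𝒜 := 𝒜) w, Finset.mul_sum]
    refine Submodule.sum_mem _ fun j _ => ?_
    have := hU.super.proj_mem (i + j) (hv _ (hW.super.proj_mem j hw))
    rwa [GradedAlgebra.proj_apply, DirectSum.coe_decompose_mul_add_of_right_mem 𝒜
      (proj_mem j w), ← GradedAlgebra.proj_apply] at this
  refine ⟨hs, fun R g v hv => mem_range_lTensor_of_coeff_mem fun l w hw => ?_⟩
  rw [← coeff_mul_one_tmul (𝒜 := 𝒜)]
  apply coeff_mem
  have hz := hW.act_mem g⁻¹ (tmul_mem_range_lTensor (1 : R) hw)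
  have hw' : (1 : R) ⊗ₜ[ℚ] w = T.act R g (T.act R g⁻¹ (1 ⊗ₜ[ℚ] w)) := by
    rw [← Module.End.mul_apply, ← map_mul, mul_inv_cancel, map_one, Module.End.one_apply]
  have := T.act_mul R g (GradedTensorProduct.of ℚ R.grading 𝒜 (1 ⊗ₜ[ℚ] v))
    (GradedTensorProduct.of ℚ R.grading 𝒜 (T.act R g⁻¹ (1 ⊗ₜ[ℚ] w)))
  rw [GradedTensorProduct.of_symm_of, GradedTensorProduct.of_symm_of, ← hw'] at this
  rw [← this, GradedTensorProduct.of_symm_of]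
  exact hU.act_mem g (one_tmul_mul_mem hs (fun v hv => hv) hv hz)

/-! ### Multiplying by all translates of an element -/

theorem span_idx_lt_mono (R : SuperCommAlg) {M N : ℕ} (h : M ≤ N) :
    Submodule.span R (stdBasis R '' {i | i.idx < M}) ≤
      Submodule.span R (stdBasis R '' {i | i.idx < N}) := by
  have : {i : SuperIndex | i.idx < M} ⊆ {i | i.idx < N} := fun i hi => lt_of_lt_of_le hi h
  exact Submodule.span_mono (Set.image_mono this)

theorem span_idx_lt_le (R : SuperCommAlg) (M K : ℕ) :
    Submodule.span R (stdBasis R '' {i | i.idx < M}) ≤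
      Submodule.span R (stdBasis R '' (block M K)ᶜ) := by
  have : {i : SuperIndex | i.idx < M} ⊆ (block M K)ᶜ := fun i hi hi' => hi'.1.not_gt hi
  exact Submodule.span_mono (Set.image_mono this)

theorem exists_mem_span_idx_lt {R : SuperCommAlg} (z : R ⊗[ℚ] StdSpace) :
    ∃ M : ℕ, z ∈ Submodule.span R (stdBasis R '' {i | i.idx < M}) := by
  have hx : z ∈ Submodule.span R (Set.range (stdBasisBasis R)) := by simp
  induction hx using Submodule.span_induction with
  | mem x hx =>
    obtain ⟨i, rfl⟩ := hx
    rw [stdBasisBasis_apply]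
    exact ⟨i.idx + 1, Submodule.subset_span ⟨i, Nat.lt_succ_self _, rfl⟩⟩
  | zero => exact ⟨0, zero_mem _⟩
  | add x y _ _ hx hy =>
    obtain ⟨M, hM⟩ := hx
    obtain ⟨N, hN⟩ := hy
    exact ⟨max M N, add_mem (span_idx_lt_mono R (le_max_left _ _) hM)
      (span_idx_lt_mono R (le_max_right _ _) hN)⟩
  | smul r x _ hx =>
    obtain ⟨M, hM⟩ := hx
    exact ⟨M, Submodule.smul_mem _ r hM⟩

theorem exists_forall_mem_span_idx_lt {R : SuperCommAlg} (f : SuperIndex → R ⊗[ℚ] StdSpace)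
    (K : ℕ) : ∃ M₀ : ℕ, ∀ M ≥ M₀, ∀ i : SuperIndex, i.idx < K →
      f i ∈ Submodule.span R (stdBasis R '' {i | i.idx < M}) := by
  choose m hm using fun i => exists_mem_span_idx_lt (f i)
  obtain ⟨M₀, hM₀⟩ := ((block_finite 0 K).image m).bddAbove
  refine ⟨M₀, fun M hM i hi => ?_⟩
  have hi' : i ∈ block 0 K := ⟨Nat.zero_le _, by omega⟩
  exact span_idx_lt_mono R ((hM₀ (Set.mem_image_of_mem m hi')).trans hM) (hm i)

/-- If the product of an even element `a` with a translate of `w` which involves none of the basis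
vectors occurring in `a` lies in a subrepresentation, then so do the products of `a` with all
translates of `w`. -/
theorem mul_coeff_act_mem {U : Submodule ℚ A} (hU : T.IsSubrep U) {K L : ℕ} {a w : A}
    (ha : a ∈ 𝒜 0) (hKa : T.HasBound K a) (hKw : T.HasBound K w) (hL : 0 + K ≤ L)
    (h : a * T.ratAct (shift ratAlg (Or.inl hL)) w ∈ U) (R : SuperCommAlg) (g : superGL R)
    (l : R →ₗ[ℚ] ℚ) : a * coeff l (T.act R g (1 ⊗ₜ[ℚ] w)) ∈ U := by
  -- Beyond position `M₀` there is room for an auxiliary block that the vectors g e_i with i < K do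
  -- not involve.
  obtain ⟨M₀, hM₀⟩ := exists_forall_mem_span_idx_lt (fun i => g.1 (stdBasis R i)) K
  obtain ⟨M, hM, hLM⟩ : ∃ M, M₀ ≤ M ∧ L + K ≤ M :=
    ⟨max M₀ (L + K), le_max_left _ _, le_max_right _ _⟩
  let f : SuperIndex → R ⊗[ℚ] StdSpace := fun i => g.1 (stdBasis R (i.withIdx (i.idx - M)))
  have hf : ∀ i ∈ block M K, f i ∈ Submodule.span R (stdBasis R '' (block M K)ᶜ) := fun i hi =>
    span_idx_lt_le R M K
      (hM₀ M hM (i.withIdx (i.idx - M)) (by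
        have := hi.1
        have := hi.2
        rw [idx_withIdx]
        omega))
  have hp : ∀ i ∈ block M K, f i ∈ superTensor R.grading stdGrading i.parity := fun i _ =>
    g.2.1 _ _ (by simpa using stdBasis_mem R (i.withIdx (i.idx - M)))
  -- For n < K, `Q t` fixes e_n and sends e_{L+n} through e_{M+n} to t e_{M+n} + g e_n. Hence `G t`
  -- sends e_n to g e_n + t e_{M+n}: an affine family through `g` at t = 0, invertible for t ≠ 0
  -- thanks to the term in t.
  let Q (t : ℚ) (ht : t ≠ 0) : superGL R :=
    triangular R (block_finite M K) ht hf hp * shift R (Or.inl hLM)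
  let G (t : ℚ) : superGL R :=
    if ht : t ≠ 0 then Q t ht * shift R (Or.inl hL) else g
  have hQ (t : ℚ) (ht : t ≠ 0) (i : SuperIndex) (hi : i.idx < K) :
      (Q t ht).1 (stdBasis R i) = stdBasis R i := by
    have h1 : i ∉ block L K := fun h => by have := h.1; omega
    have h2 : i ∉ block M K := fun h => by have := h.1; omega
    rw [Subgroup.coe_mul, LinearEquiv.mul_apply, shift_of_notMem _ h1 h2, triangular_of_notMem h2]
  have hG : IsAffineFamily R K G := by
    refine ⟨fun i => g.1 (stdBasis R i), fun i => stdBasis R (i.withIdx (i.idx + M)),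
      fun t i hi => ?_⟩
    by_cases ht : t = 0
    · simp [G, ht]
    · have h0 : i ∈ block 0 K := ⟨Nat.zero_le _, by omega⟩
      have h1 : i.withIdx (i.idx - 0 + L) ∈ block L K := by
        constructor <;> rw [idx_withIdx] <;> omega
      have h2 : i.withIdx (i.idx + M) ∈ block M K := by
        constructor <;> rw [idx_withIdx] <;> omega
      simp only [G, Q, dif_pos (show t ≠ 0 from ht), Subgroup.coe_mul, LinearEquiv.mul_apply]
      rw [shift_of_mem _ h0, shift_of_mem _ h1]
      simp only [idx_withIdx, withIdx_withIdx, Nat.sub_zero, Nat.add_sub_cancel]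
      rw [triangular_of_mem h2, add_comm]
      simp [f]
  have hpoly := polyFun_map (LinearMap.mulLeft ℚ a ∘ₗ coeff l) (hKw R G hG)
  have := polyFun_zero_mem hpoly U fun t ht => ?_
  · simpa [G] using this
  · have hGt : T.act R (G t) (1 ⊗ₜ[ℚ] w) = T.act R (Q t ht)
        (1 ⊗ₜ[ℚ] T.ratAct (shift ratAlg (Or.inl hL)) w) := by
      simp only [G, dif_pos ht]
      rw [map_mul, Module.End.mul_apply, act_baseChange (isBaseChangeOf_shift _)]
    -- As `Q t` fixes a, the product a · G(t)w is `Q t` applied to a times the shift of w, which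
    -- lies in `U`.
    have hmul := T.act_one_tmul_mul R (Q t ht) a (T.ratAct (shift ratAlg (Or.inl hL)) w)
    rw [hKa.act_eq_self (hQ t ht), even_one_tmul_mul ha] at hmul
    rw [LinearMap.comp_apply, LinearMap.mulLeft_apply, ← coeff_lTensor_mulLeft, hGt,
      ← (GradedTensorProduct.of ℚ R.grading 𝒜).injective hmul]
    exact coeff_mem (hU.stable R _ _ h)

variable (T) in
/-- The elements all of whose translates are multiplied into `U` by `a`. -/
def translateColon (U : Submodule ℚ A) (a : A) : Submodule ℚ A where
  carrier := {w | ∀ (R : SuperCommAlg) (g : superGL R) (l : R →ₗ[ℚ] ℚ),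
    a * coeff l (T.act R g (1 ⊗ₜ[ℚ] w)) ∈ U}
  add_mem' hx hy R g l := by
    rw [TensorProduct.tmul_add, map_add, map_add, mul_add]
    exact add_mem (hx R g l) (hy R g l)
  zero_mem' R g l := by simp
  smul_mem' c x hx R g l := by
    rw [TensorProduct.tmul_smul, LinearMap.map_smul_of_tower, map_smul, mul_smul_comm]
    exact U.smul_mem c (hx R g l)

/-- By `mul_coeff_act_mem` a single rational shift has to be tested. It commutes with taking
coefficients, so it merges with `g` into one point over `R`; points over two different superalgebras
never have to be composed. -/
theorem coeff_act_mem_translateColon {U : Submodule ℚ A} (hU : T.IsSubrep U) {a w : A}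
    (ha : a ∈ 𝒜 0) (hw : w ∈ T.translateColon U a) (R : SuperCommAlg) (g : superGL R)
    (l : R →ₗ[ℚ] ℚ) : coeff l (T.act R g (1 ⊗ₜ[ℚ] w)) ∈ T.translateColon U a := by
  obtain ⟨K₁, h₁⟩ := T.polynomial.exists_hasBound a
  obtain ⟨K₂, h₂⟩ := T.polynomial.exists_hasBound (coeff l (T.act R g (1 ⊗ₜ[ℚ] w)))
  let K := max K₁ K₂
  have hL : 0 + K ≤ K := by omega
  refine mul_coeff_act_mem hU ha (h₁.mono (le_max_left _ _)) (h₂.mono (le_max_right _ _)) hL ?_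
  have key (z : R ⊗[ℚ] A) : coeff l (T.act R (shift R (Or.inl hL)) z) =
      T.ratAct (shift ratAlg (Or.inl hL)) (coeff l z) := by
    induction z using TensorProduct.induction_on with
    | zero => simp
    | tmul r b =>
      have : r ⊗ₜ[ℚ] b = r • ((1 : R) ⊗ₜ[ℚ] b) := by simp [TensorProduct.smul_tmul']
      rw [coeff_tmul, map_smul, this, map_smul, act_baseChange (isBaseChangeOf_shift _)]
      simp [TensorProduct.smul_tmul']
    | add x y hx hy => simp only [map_add, hx, hy]
  rw [← key, ← Module.End.mul_apply, ← map_mul]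
  exact hw R _ l

variable (T) in
/-- The largest super subspace of `translateColon`. -/
def homogeneousTranslateColon (U : Submodule ℚ A) (a : A) : Submodule ℚ A :=
  ⨅ i, (T.translateColon U a).comap (GradedAlgebra.proj 𝒜 i)

/-- Translates of a homogeneous element are homogeneous in R ⊗ A, so by `proj_coeff` the components
of their coefficients are again coefficients, to which `coeff_act_mem_translateColon` applies. -/
theorem isSubrep_homogeneousTranslateColon {U : Submodule ℚ A} (hU : T.IsSubrep U) {a : A}
    (ha : a ∈ 𝒜 0) : T.IsSubrep (T.homogeneousTranslateColon U a) := by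
  constructor
  · refine isSuperSubspace_of_proj_mem fun i w hw => ?_
    simp only [homogeneousTranslateColon, Submodule.mem_iInf, Submodule.mem_comap] at hw ⊢
    intro j
    by_cases h : i = j
    · subst h
      rw [proj_of_mem (proj_mem i w)]
      exact hw i
    · rw [proj_of_mem_ne (proj_mem i w) h]
      exact zero_mem _
  · refine fun R g w hw => mem_range_lTensor_of_coeff_mem fun l => ?_
    simp only [homogeneousTranslateColon, Submodule.mem_iInf, Submodule.mem_comap] at hw ⊢
    intro i
    rw [← sum_proj (𝒜 := 𝒜) w]
    simp only [TensorProduct.tmul_sum, map_sum]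
    refine Submodule.sum_mem _ fun j _ => ?_
    rw [proj_coeff (T.act_even R g j _ (one_tmul_mem_superTensor (proj_mem j w)))]
    exact coeff_act_mem_translateColon hU ha (hw j) R g _

/-- For a `GL`-prime `p`, if `a b'` lies in `p` for a translate `b'` of `b` which involves none of the
basis vectors occurring in `a` or `b`, then `a` or `b` lies in `p`. -/
theorem IsGLPrime.mem_or_mem {p : Ideal A} (hp : T.IsGLPrime p) {K L : ℕ} {a b : A}
    (ha : a ∈ 𝒜 0) (hb : b ∈ 𝒜 0) (hKa : T.HasBound K a) (hKb : T.HasBound K b) (hL : 0 + K ≤ L)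
    (h : a * T.ratAct (shift ratAlg (Or.inl hL)) b ∈ p) : a ∈ p ∨ b ∈ p := by
  have hpU : T.IsSubrep (p.restrictScalars ℚ) := hp.isGLIdeal
  have hW := isSubrep_homogeneousTranslateColon hpU ha
  have hbW : b ∈ T.homogeneousTranslateColon (p.restrictScalars ℚ) a := by
    simp only [homogeneousTranslateColon, Submodule.mem_iInf, Submodule.mem_comap]
    intro i
    by_cases hi : 0 = i
    · subst hi
      rw [proj_of_mem hb]
      exact mul_coeff_act_mem hpU ha hKa hKb hL h
    · rw [proj_of_mem_ne hb hi]
      exact zero_mem _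
  have haV : a ∈ colon (p.restrictScalars ℚ) (T.homogeneousTranslateColon (p.restrictScalars ℚ) a) := by
    intro w hw
    rw [← sum_proj (𝒜 := 𝒜) w, Finset.mul_sum]
    refine Submodule.sum_mem _ fun i _ => ?_
    simp only [homogeneousTranslateColon, Submodule.mem_iInf, Submodule.mem_comap] at hw
    -- The identity, as a rational point, has the component of `w` itself as its coefficient.
    simpa using hw i ratAlg 1 LinearMap.id
  rcases hp.subrep_le _ _ (isSubrep_colon hpU hW) hW
    (Submodule.mul_le.2 fun v hv w hw => hv w hw) with h | h
  · exact Or.inl (h haV)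
  · exact Or.inr (h hbW)

end SuperTCA

/-! ### Supercommutative algebras -/

section SuperCommutative

variable {A : Type u} [Ring A] [Algebra ℚ A] {𝒜 : ZMod 2 → Submodule ℚ A}

theorem IsSuperCommutative.mul_self_eq_zero (h : IsSuperCommutative 𝒜) {a : A} (ha : a ∈ 𝒜 1) :
    a * a = 0 := by
  have h1 := h 1 1 a a ha ha
  rw [mul_one, uzpow_one, Units.neg_smul, one_smul] at h1
  have h2 : (2 : ℚ) • (a * a) = 0 := by
    rw [two_smul]
    nth_rewrite 1 [h1]
    exact neg_add_cancel _
  exact (smul_eq_zero.1 h2).resolve_left two_ne_zero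

variable [GradedAlgebra 𝒜]

theorem IsSuperCommutative.even_mul_comm (h : IsSuperCommutative 𝒜) {a : A} (ha : a ∈ 𝒜 0)
    (b : A) : a * b = b * a := by
  rw [← sum_proj (𝒜 := 𝒜) b, Finset.mul_sum, Finset.sum_mul]
  refine Finset.sum_congr rfl fun i _ => ?_
  rw [h 0 i a _ ha (proj_mem i b), zero_mul, uzpow_zero, one_smul]

theorem proj_zero_add_proj_one (a : A) :
    GradedAlgebra.proj 𝒜 0 a + GradedAlgebra.proj 𝒜 1 a = a := by
  conv_rhs => rw [← sum_proj (𝒜 := 𝒜) a]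
  exact (Fin.sum_univ_two (fun i : ZMod 2 => GradedAlgebra.proj 𝒜 i a)).symm

theorem odd_mul_odd_mem {a b : A} (ha : a ∈ 𝒜 1) (hb : b ∈ 𝒜 1) : a * b ∈ 𝒜 0 :=
  SetLike.mul_mem_graded (A := 𝒜) ha hb

theorem even_mul_mem {i : ZMod 2} {a b : A} (ha : a ∈ 𝒜 0) (hb : b ∈ 𝒜 i) : a * b ∈ 𝒜 i := by
  simpa using SetLike.mul_mem_graded (A := 𝒜) ha hb

theorem proj_zero_mul (a b : A) :
    GradedAlgebra.proj 𝒜 0 (a * b) = GradedAlgebra.proj 𝒜 0 a * GradedAlgebra.proj 𝒜 0 b +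
      GradedAlgebra.proj 𝒜 1 a * GradedAlgebra.proj 𝒜 1 b := by
  have h0 := proj_mem (𝒜 := 𝒜) 0 a
  have h1 := proj_mem (𝒜 := 𝒜) 1 a
  have h0' := proj_mem (𝒜 := 𝒜) 0 b
  have h1' := proj_mem (𝒜 := 𝒜) 1 b
  conv_lhs => rw [← proj_zero_add_proj_one (𝒜 := 𝒜) a, ← proj_zero_add_proj_one (𝒜 := 𝒜) b]
  have h10 : GradedAlgebra.proj 𝒜 1 a * GradedAlgebra.proj 𝒜 0 b ∈ 𝒜 1 := by
    simpa using SetLike.mul_mem_graded (A := 𝒜) h1 h0'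
  rw [add_mul, mul_add, mul_add, map_add, map_add, map_add, proj_of_mem (even_mul_mem h0 h0'),
    proj_of_mem_ne (even_mul_mem h0 h1') one_ne_zero, proj_of_mem_ne h10 one_ne_zero,
    proj_of_mem (odd_mul_odd_mem h1 h1'), add_zero, zero_add]

/-- The even part of a supercommutative algebra is a commutative ring. -/
abbrev IsSuperCommutative.evenCommRing (h : IsSuperCommutative 𝒜) : CommRing (𝒜 0) where
  mul_comm a b := Subtype.ext (h.even_mul_comm a.2 b)

/-- The odd part squares to zero, so the binomial expansion stops after its linear term. -/
theorem IsSuperCommutative.exists_pow_eq (h : IsSuperCommutative 𝒜) (x : A) (n : ℕ) :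
    ∃ d ∈ 𝒜 0, x ^ n = GradedAlgebra.proj 𝒜 0 x ^ n + d * GradedAlgebra.proj 𝒜 1 x := by
  induction n with
  | zero => exact ⟨0, zero_mem _, by simp⟩
  | succ n ih =>
    obtain ⟨d, hd, hn⟩ := ih
    have h0 := proj_mem (𝒜 := 𝒜) 0 x
    have h1 := proj_mem (𝒜 := 𝒜) 1 x
    have h0n : GradedAlgebra.proj 𝒜 0 x ^ n ∈ 𝒜 0 := by
      simpa using SetLike.pow_mem_graded (A := 𝒜) n h0
    refine ⟨GradedAlgebra.proj 𝒜 0 x ^ n + d * GradedAlgebra.proj 𝒜 0 x,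
      add_mem h0n (even_mul_mem hd h0), ?_⟩
    rw [pow_succ, hn]
    conv_lhs => enter [2]; rw [← proj_zero_add_proj_one (𝒜 := 𝒜) x]
    rw [add_mul, mul_add, mul_add, mul_assoc d, mul_assoc d, h.mul_self_eq_zero h1,
      ← h.even_mul_comm h0 (GradedAlgebra.proj 𝒜 1 x), pow_succ]
    noncomm_ring

/-- The even part of xⁿ is x₀ⁿ, and `p` is homogeneous. Conversely (x₀ⁿ + d x₁)² is a multiple of
x₀ⁿ because (d x₁)² = 0, which accounts for the exponent `n + n`. -/
theorem IsSuperCommutative.exists_pow_mem_iff (h : IsSuperCommutative 𝒜) {p : Ideal A}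
    (hp : IsSuperSubspace 𝒜 (p.restrictScalars ℚ)) (x : A) :
    (∃ n : ℕ, x ^ n ∈ p) ↔ ∃ n : ℕ, GradedAlgebra.proj 𝒜 0 x ^ n ∈ p := by
  have h0 := proj_mem (𝒜 := 𝒜) 0 x
  have h1 := proj_mem (𝒜 := 𝒜) 1 x
  have h0n (n : ℕ) : GradedAlgebra.proj 𝒜 0 x ^ n ∈ 𝒜 0 := by
    simpa using SetLike.pow_mem_graded (A := 𝒜) n h0
  constructor
  · rintro ⟨n, hn⟩
    obtain ⟨d, hd, hx⟩ := h.exists_pow_eq x n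
    have := hp.proj_mem 0 hn
    rw [hx, map_add, proj_of_mem (h0n n), proj_of_mem_ne (even_mul_mem hd h1) one_ne_zero,
      add_zero] at this
    exact ⟨n, this⟩
  · rintro ⟨n, hn⟩
    obtain ⟨d, hd, hx⟩ := h.exists_pow_eq x n
    refine ⟨n + n, ?_⟩
    rw [pow_add, hx]
    have hodd : d * GradedAlgebra.proj 𝒜 1 x ∈ 𝒜 1 := even_mul_mem hd h1
    rw [add_mul, mul_add, mul_add, h.mul_self_eq_zero hodd, h.even_mul_comm (h0n n)
      (d * GradedAlgebra.proj 𝒜 1 x), add_zero]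
    exact p.add_mem (p.add_mem (p.mul_mem_left _ hn) (p.mul_mem_left _ hn)) (p.mul_mem_left _ hn)

end SuperCommutative

namespace SuperTCA

variable {A : Type u} [Ring A] [Algebra ℚ A] {𝒜 : ZMod 2 → Submodule ℚ A} [GradedAlgebra 𝒜]
  {T : SuperTCA 𝒜}

/-! ### The radical of a `GL`-prime -/

theorem isAffineFamily_shear (R : SuperCommAlg) {L M K : ℕ} (h : L + K ≤ M ∨ M + K ≤ L) (c : ℚ)
    (K' : ℕ) : IsAffineFamily R K' fun t => shear R h (t * c) := by
  classical
  refine ⟨stdBasis R,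
    fun i => if i ∈ block L K then c • stdBasis R (i.withIdx (i.idx - L + M)) else 0,
    fun t i _ => ?_⟩
  beta_reduce
  by_cases hi : i ∈ block L K
  · rw [shear_of_mem h hi, if_pos hi, mul_smul]
  · rw [shear_of_notMem h hi, if_neg hi, smul_zero, add_zero]

theorem shear_zero (R : SuperCommAlg) {L M K : ℕ} (h : L + K ≤ M ∨ M + K ≤ L) (i : SuperIndex) :
    (shear R h 0).1 (stdBasis R i) = stdBasis R i := by
  by_cases hi : i ∈ block L K
  · rw [shear_of_mem h hi, zero_smul, add_zero]
  · rw [shear_of_notMem h hi]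

theorem HasBound.ratAct_eq_self {K : ℕ} {a : A} (ha : T.HasBound K a) {g : superGL ratAlg}
    (hg : ∀ i, g.1 (stdBasis ratAlg i) = stdBasis ratAlg i) : T.ratAct g a = a := by
  rw [ratAct_apply, ha.act_eq_self fun i _ => hg i]
  simp

/-- The radical of a `GL`-ideal is compatible with affine families of rational points: if it contains
`x y`, then it contains the products of `x` with the members of the family of translates of `y`. -/
theorem mul_ratAct_mem_radical {p : Ideal A} (hp : T.IsGLIdeal p) {K : ℕ} {x y : A} (hx : x ∈ 𝒜 0)
    (hy : y ∈ 𝒜 0) (hKx : T.HasBound K x) (hKy : T.HasBound K y) {G : ℚ → superGL ratAlg}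
    (hG : IsAffineFamily ratAlg K G) (hG0 : ∀ i, (G 0).1 (stdBasis ratAlg i) = stdBasis ratAlg i)
    (h : ∃ n : ℕ, (x * y) ^ n ∈ p) (s : ℚ) : ∃ n : ℕ, (x * T.ratAct (G s) y) ^ n ∈ p := by
  let _ : CommRing (𝒜 0) := T.supercomm.evenCommRing
  obtain ⟨n, hn⟩ := h
  let p₀ : Ideal (𝒜 0) :=
    { carrier := {a | (a : A) ∈ p}
      add_mem' := fun ha hb => p.add_mem ha hb
      zero_mem' := p.zero_mem
      smul_mem' := fun c _ ha => p.mul_mem_left (c : A) ha }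
  let act (t : ℚ) (a : 𝒜 0) : 𝒜 0 := ⟨T.ratAct (G t) a, ratAct_mem _ a.2⟩
  have key : (⟨x, hx⟩ * act s ⟨y, hy⟩ : 𝒜 0) ∈ p₀.radical := by
    -- Testing membership on primes of A₀ supplies the domain in which the polynomial functions take
    -- their values.
    rw [Ideal.radical_eq_sInf, Ideal.mem_sInf]
    rintro q ⟨hpq, hq⟩
    -- The polynomial functions at hand are `A`-valued, so the quotient map of A₀ is extended to all
    -- of `A` by projecting first.
    let π : A →ₗ[ℚ] 𝒜 0 ⧸ q := (Ideal.Quotient.mkₐ ℚ q).toLinearMap ∘ₗ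
      (GradedAlgebra.proj 𝒜 0).codRestrict (𝒜 0) (proj_mem 0)
    have hπ (a : 𝒜 0) : π a = Ideal.Quotient.mk q a := by
      have : (GradedAlgebra.proj 𝒜 0).codRestrict (𝒜 0) (proj_mem 0) (a : A) = a :=
        Subtype.ext (proj_of_mem a.2)
      rw [LinearMap.comp_apply, this]
      rfl
    have hzero (t : ℚ) : π (T.ratAct (G t) x) * π (T.ratAct (G t) y) = 0 := by
      have h1 := hπ (act t ⟨x, hx⟩)
      have h2 := hπ (act t ⟨y, hy⟩)
      have h3 : (act t ⟨x, hx⟩ * act t ⟨y, hy⟩) ^ n ∈ p₀ := by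
        change ((T.ratAct (G t) x * T.ratAct (G t) y) ^ n : A) ∈ p
        rw [← map_mul, ← map_pow]
        exact ratAct_mem_subrep hp (G t) hn
      rw [h1, h2, ← map_mul]
      exact Ideal.Quotient.eq_zero_iff_mem.2 (hq.mem_of_pow_mem n (hpq h3))
    rcases polyFun_eq_zero_or (polyFun_map π (polyFun_ratAct hKx hG))
      (polyFun_map π (polyFun_ratAct hKy hG)) hzero with h | h
    · have := h 0
      rw [HasBound.ratAct_eq_self hKx hG0, hπ ⟨x, hx⟩] at this
      exact q.mul_mem_right _ (Ideal.Quotient.eq_zero_iff_mem.1 this)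
    · have := h s
      rw [hπ (act s ⟨y, hy⟩)] at this
      exact q.mul_mem_left _ (Ideal.Quotient.eq_zero_iff_mem.1 this)
  obtain ⟨m, hm⟩ := key
  exact ⟨m, hm⟩

theorem IsGLPrime.even_mem_or_mem {p : Ideal A} (hp : T.IsGLPrime p) {x y : A} (hx : x ∈ 𝒜 0)
    (hy : y ∈ 𝒜 0) (h : ∃ n : ℕ, (x * y) ^ n ∈ p) :
    (∃ n : ℕ, x ^ n ∈ p) ∨ ∃ n : ℕ, y ^ n ∈ p := by
  obtain ⟨K₁, h₁⟩ := T.polynomial.exists_hasBound x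
  obtain ⟨K₂, h₂⟩ := T.polynomial.exists_hasBound y
  let K := max K₁ K₂
  replace h₁ : T.HasBound K x := h₁.mono (le_max_left _ _)
  replace h₂ : T.HasBound K y := h₂.mono (le_max_right _ _)
  have hL : 0 + K ≤ K := by omega
  have hL' : 0 + K ≤ K ∨ K + K ≤ 0 := Or.inl hL
  -- The two shears composing `shift` are applied to y in turn, with coefficients 1 and then −1,
  -- each reached from the identity at parameter 1; x stays in place.
  have step1 := mul_ratAct_mem_radical hp.isGLIdeal hx hy h₁ h₂
    (isAffineFamily_shear ratAlg hL' 1 K)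
    (fun i => by rw [zero_mul, shear_zero]) h 1
  simp only [one_mul] at step1
  obtain ⟨K₃, h₃⟩ := T.polynomial.exists_hasBound (T.ratAct (shear ratAlg hL' 1) y)
  obtain ⟨n, hn⟩ := mul_ratAct_mem_radical hp.isGLIdeal hx (ratAct_mem _ hy)
    (h₁.mono (le_max_left K K₃)) (h₃.mono (le_max_right K K₃))
    (isAffineFamily_shear ratAlg hL'.symm (-1) _)
    (fun i => by rw [zero_mul, shear_zero]) step1 1
  rw [one_mul, ← ratAct_mul, Commute.mul_pow (T.supercomm.even_mul_comm hx _),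
    ← map_pow] at hn
  have hpow {a : A} (ha : a ∈ 𝒜 0) : a ^ n ∈ 𝒜 0 := by
    simpa using SetLike.pow_mem_graded (A := 𝒜) n ha
  exact (hp.mem_or_mem (hpow hx) (hpow hy) (HasBound.pow h₁ n) (HasBound.pow h₂ n) hL hn).imp
    (fun h => ⟨n, h⟩) fun h => ⟨n, h⟩

end SuperTCA

theorem mainTheorem7 {A : Type u} [Ring A] [Algebra ℚ A] (𝒜 : ZMod 2 → Submodule ℚ A)
    [GradedAlgebra 𝒜] (T : SuperTCA 𝒜) (p : Ideal A) (hp : T.IsGLPrime p) :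
    ∃ P : Ideal A, (∀ x : A, x ∈ P ↔ ∃ n : ℕ, x ^ n ∈ p) ∧ P.IsTwoSided ∧ P.IsPrime := by
  let _ : CommRing (𝒜 0) := T.supercomm.evenCommRing
  have hrad := T.supercomm.exists_pow_mem_iff hp.isGLIdeal.super
  let p₀ : Ideal (𝒜 0) :=
    { carrier := {a | (a : A) ∈ p}
      add_mem' := fun ha hb => p.add_mem ha hb
      zero_mem' := p.zero_mem
      smul_mem' := fun c _ ha => p.mul_mem_left (c : A) ha }
  let e : A →ₗ[ℚ] 𝒜 0 := (GradedAlgebra.proj 𝒜 0).codRestrict (𝒜 0) (proj_mem 0)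
  have he (x : A) : e x ∈ p₀.radical ↔ ∃ n : ℕ, x ^ n ∈ p := (hrad x).symm
  -- The defect z is x₁y₁, which has square zero. So `e` is multiplicative modulo the radical,
  -- although it is not a ring homomorphism.
  have hmul (x y : A) : ∃ z ∈ p₀.radical, e (x * y) = e x * e y + z := by
    have h1 := proj_mem (𝒜 := 𝒜) 1 x
    have h1' := proj_mem (𝒜 := 𝒜) 1 y
    refine ⟨⟨_, odd_mul_odd_mem h1 h1'⟩, ⟨2, ?_⟩, Subtype.ext (proj_zero_mul x y)⟩
    change (GradedAlgebra.proj 𝒜 1 x * GradedAlgebra.proj 𝒜 1 y) ^ 2 ∈ p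
    rw [pow_two, mul_assoc, ← T.supercomm.even_mul_comm (odd_mul_odd_mem h1 h1'), mul_assoc,
      T.supercomm.mul_self_eq_zero h1', mul_zero, mul_zero]
    exact p.zero_mem
  let P : Ideal A :=
    { carrier := {x | e x ∈ p₀.radical}
      add_mem' := fun {x y} hx hy => by
        change e (x + y) ∈ p₀.radical
        rw [map_add]
        exact add_mem hx hy
      zero_mem' := by
        change e 0 ∈ p₀.radical
        rw [map_zero]
        exact zero_mem _
      smul_mem' := fun a x hx => by
        change e (a * x) ∈ p₀.radical
        obtain ⟨z, hz, h⟩ := hmul a x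
        rw [h]
        exact add_mem (p₀.radical.mul_mem_left _ hx) hz }
  refine ⟨P, he, ⟨fun {x} y hx => ?_⟩, ⟨fun htop => ?_, fun {x y} hxy => ?_⟩⟩
  · change e (x * y) ∈ p₀.radical
    obtain ⟨z, hz, h⟩ := hmul x y
    rw [h]
    exact add_mem (p₀.radical.mul_mem_right _ hx) hz
  · obtain ⟨n, hn⟩ := (he 1).1 ((Ideal.eq_top_iff_one P).1 htop)
    rw [one_pow] at hn
    exact hp.ne_top ((Ideal.eq_top_iff_one p).2 hn)
  · change e (x * y) ∈ p₀.radical at hxy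
    obtain ⟨z, hz, h⟩ := hmul x y
    rw [h] at hxy
    obtain ⟨n, hn⟩ := (Submodule.add_mem_iff_left _ hz).1 hxy
    exact (hp.even_mem_or_mem (proj_mem 0 x) (proj_mem 0 y) ⟨n, hn⟩).imp
      (fun h => (he x).2 ((hrad x).2 h)) fun h => (he y).2 ((hrad y).2 h)
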